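/- Call a set $\Lambda\subset\mathbb R$ without finite accumulation points a discrete sequence. A short partition is a family of intervals $I_n=(a_n,a_{n+1}]$, $n\in\mathbb Z$, where $\dots<a_{-1}<a_0=0<a_1<\dots$ are real, $|I_n|\to\infty$ as $n\to\pm\infty$, and $\sum_n \frac{|I_n|^2}{1+\operatorname{dist}^2(0,I_n)}<\infty$. For $d>0$, a discrete sequence $\Lambda$ is called $d$-uniform if there is a short partition $\{I_n\}$ such that $\Delta_n:=\#(\Lambda\cap I_n)=d|I_n|+o(|I_n|)$ as $n\to\pm\infty$ and $$\sum_n\frac{\Delta_n^2\log|I_n|-E_n}{1+\operatorname{dist}^2(0,I_n)}<\infty,\qquad E_n=\sum_{\substack{\lambda,\lambda'\in\Lambda\cap I_n\\ \lambda\ne\lambda'}}\log|\lambda-\lambda'|,$$ where the sum defining $E_n$ is over ordered pairs. Let $\Lambda$ be a $d$-uniform sequence. (1) If $\Gamma\subset\Lambda$ is a $c$-uniform sequence and $c\neq d$, then $\Lambda\setminus\Gamma$ contains a $(d-c)$-uniform subsequence (in particular $c<d$). (2) If $\Gamma_1\subset\Lambda$ is $c_1$-uniform, $\Gamma_2\subset\Lambda$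 is $c_2$-uniform and $\Gamma_1\cap\Gamma_2=\emptyset$, then $\Gamma_1\cup\Gamma_2$ contains a $(c_1+c_2)$-uniform subsequence. -/

import Mathlib

open Set Filter Topology Asymptotics

noncomputable section

namespace UniformSeq

/-- A discrete sequence of distinct real points, recorded as the set of its points:
a set without finite accumulation points. -/
def IsDiscreteSeq (L : Set ℝ) : Prop := ∀ x : ℝ, ¬ AccPt x (𝓟 L)

/-- The interval `I_n = (a_n, a_{n+1}]` determined by a two-sided sequence `a`. -/
def interval (a : ℤ → ℝ) (n : ℤ) : Set ℝ := Ioc (a n) (a (n + 1))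

/-- The length `|I_n|`. -/
def len (a : ℤ → ℝ) (n : ℤ) : ℝ := a (n + 1) - a n

/-- The weight `1 + dist²(0, I_n)`. -/
def weight (a : ℤ → ℝ) (n : ℤ) : ℝ := 1 + Metric.infDist 0 (interval a n) ^ 2

/-- The intervals `I_n = (a_n, a_{n+1}]` form a short partition of the real line:
`⋯ < a_{-1} < a_0 = 0 < a_1 < ⋯`, `|I_n| → ∞` as `n → ±∞`, and
`∑ |I_n|² / (1 + dist²(0, I_n)) < ∞`. -/
structure IsShortPartition (a : ℤ → ℝ) : Prop where
  strictMono : StrictMono a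
  zero : a 0 = 0
  tendsto_len : Tendsto (len a) (atBot ⊔ atTop) atTop
  short : Summable fun n : ℤ => len a n ^ 2 / weight a n

/-- For a finite set `S` of real points, the sum of `log |x - y|` over all ordered pairs
of distinct points `x, y` of `S`. -/
def energy (S : Set ℝ) : ℝ := ∑ᶠ p ∈ S.offDiag, Real.log |p.1 - p.2|

/-- `Δ_n`, the number of points of `L` in `I_n`. -/
def count (L : Set ℝ) (a : ℤ → ℝ) (n : ℤ) : ℕ := (L ∩ interval a n).ncard

/-- Density condition: `Δ_n = d |I_n| + o(|I_n|)` as `n → ±∞`. -/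
def DensityCondition (d : ℝ) (L : Set ℝ) (a : ℤ → ℝ) : Prop :=
  (fun n : ℤ => (count L a n : ℝ) - d * len a n) =o[atBot ⊔ atTop] (len a)

/-- Energy condition: `∑ (Δ_n² log |I_n| - E_n) / (1 + dist²(0, I_n)) < ∞`, where
`E_n` is the energy of `L ∩ I_n`. The terms with `|I_n| ≥ 1` are nonnegative, so on a short
partition all but finitely many terms are, and finiteness of the sum is summability. -/
def EnergyCondition (L : Set ℝ) (a : ℤ → ℝ) : Prop :=
  Summable fun n : ℤ =>
    ((count L a n : ℝ) ^ 2 * Real.log (len a n) - energy (L ∩ interval a n)) / weight a n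

/-- `L` is a `d`-uniform sequence (`d > 0`). -/
def IsUniform (d : ℝ) (L : Set ℝ) : Prop :=
  0 < d ∧ IsDiscreteSeq L ∧
    ∃ a : ℤ → ℝ, IsShortPartition a ∧ DensityCondition d L a ∧ EnergyCondition L a

end UniformSeq

end

noncomputable section

namespace UniformSeq


/-! Up to the harmless term Δ log|I|, the energy numerator is a sum over pairs of log(|I| / |x - y|)
≥ 0, so on a fixed partition the condition passes to subsets. The energies of Γ, Γ₁, Γ₂ are never
used; only their densities matter, and the energy of the new sequence comes from Λ. The difficulty
is that each density is known on a partition of its own.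

`exists_coarsening` merges intervals of Λ's partition until those of the other partition that meet
an endpoint are negligible. The other density then holds on the merged partition, where densities
add and subtract.

Merging creates pairs from different old cells, which the old energy does not see. At each dyadic
distance, bounded density lets one count them by same-cell pairs at twice that distance
(`card_near_le`). Summing over scales, `logEnergy_le` bounds the energy of a block of length R by
the old energies plus O(R²), plus a term J · O(R), where J is the number of scales that cross pairs
can reach.

Points almost touching across an old endpoint would make J huge. So
`exists_negligible_energyCondition` deletes from Λ the points within exp(-T) to the right of each
old endpoint, with T about R + E/R and E the old energy of the block. Few points are lost, since
crowding is expensive in energy, and J · R becomes O(R² + E), which is summable against the weights.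
Both claims follow by deleting this set from Λ \ Γ or Γ₁ ∪ Γ₂. -/

/-- The sum of `log (R / |x - y|)` over ordered pairs of distinct points of `S`. -/
def logEnergy (R : ℝ) (S : Finset ℝ) : ℝ := ∑ p ∈ S.offDiag, Real.log (R / |p.1 - p.2|)

/-! ### Counting close pairs through pairs in a common cell -/

/-- Cells strictly between the first and the last occupied one have total length at most `s`, hence
hold at most `C * s` points. All other points lie in two cells, whose squared counts are counts of
same-cell pairs. -/
theorem card_sq_le_of_diam {S : Finset ℝ} {a : ℤ → ℝ} (ha : Monotone a) {π : ℝ → ℤ}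
    (hπ : ∀ x, a (π x) < x ∧ x ≤ a (π x + 1)) {C : ℝ} (hC0 : 0 ≤ C)
    (hC : ∀ n, ((S.filter fun x => π x = n).card : ℝ) ≤ C * (a (n + 1) - a n))
    {s : ℝ} (hs : ∀ x ∈ S, ∀ y ∈ S, |x - y| ≤ s) :
    (S.card : ℝ) ^ 2 ≤ 2 * C * s * S.card
      + 4 * ((S ×ˢ S).filter fun p => π p.1 = π p.2).card := by
  classical
  rcases S.eq_empty_or_nonempty with rfl | hne
  · simp
  set x₀ := S.min' hne
  set x₁ := S.max' hne
  have hx₀ : x₀ ∈ S := S.min'_mem hne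
  have hx₁ : x₁ ∈ S := S.max'_mem hne
  have hmono : ∀ x y, x ≤ y → π x ≤ π y := by
    intro x y hxy
    by_contra! h
    have := ha (show π y + 1 ≤ π x by omega)
    linarith [(hπ x).1, (hπ y).2]
  have hsub : S ⊆ (S.filter fun x => π x = π x₀) ∪ (S.filter fun x => π x = π x₁) ∪
      (Finset.Ico (π x₀ + 1) (π x₁)).biUnion fun n => S.filter fun x => π x = n := by
    intro x hx
    have h0 := hmono _ _ (S.min'_le x hx)
    have h1 := hmono _ _ (S.le_max' x hx)
    simp only [Finset.mem_union, Finset.mem_filter, Finset.mem_biUnion, Finset.mem_Ico]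
    by_cases e0 : π x = π x₀
    · exact Or.inl (Or.inl ⟨hx, e0⟩)
    by_cases e1 : π x = π x₁
    · exact Or.inl (Or.inr ⟨hx, e1⟩)
    refine Or.inr ⟨π x, ⟨?_, ?_⟩, hx, rfl⟩
    · change π x₀ ≤ π x at h0; omega
    · change π x ≤ π x₁ at h1; omega
  have hs0 : 0 ≤ s := (abs_nonneg _).trans (hs _ hx₀ _ hx₀)
  have htel : ∀ p q : ℤ, p ≤ q → ∑ n ∈ Finset.Ico p q, (a (n + 1) - a n) = a q - a p := by
    intro p q hpq
    induction q, hpq using Int.leInduction with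
    | base => simp
    | succ q hq ih =>
      rw [← Finset.insert_Ico_right_eq_Ico_add_one hq, Finset.sum_insert (by simp), ih]
      ring
  have hmid : (((Finset.Ico (π x₀ + 1) (π x₁)).biUnion fun n =>
      S.filter fun x => π x = n).card : ℝ) ≤ C * s := by
    rcases le_or_gt (π x₀ + 1) (π x₁) with h | h
    · calc (((Finset.Ico (π x₀ + 1) (π x₁)).biUnion fun n => S.filter fun x => π x = n).card : ℝ)
          ≤ ∑ n ∈ Finset.Ico (π x₀ + 1) (π x₁), ((S.filter fun x => π x = n).card : ℝ) := by
            exact_mod_cast Finset.card_biUnion_le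
        _ ≤ ∑ n ∈ Finset.Ico (π x₀ + 1) (π x₁), C * (a (n + 1) - a n) :=
            Finset.sum_le_sum fun n _ => hC n
        _ = C * (a (π x₁) - a (π x₀ + 1)) := by rw [← Finset.mul_sum, htel _ _ h]
        _ ≤ C * s := by
            refine mul_le_mul_of_nonneg_left ?_ hC0
            have := hs _ hx₁ _ hx₀
            have := le_abs_self (x₁ - x₀)
            linarith [(hπ x₀).2, (hπ x₁).1]
    · rw [Finset.Ico_eq_empty (by omega)]
      simpa using mul_nonneg hC0 hs0
  have hpart : ∀ n, ((S.filter fun x => π x = n).card : ℝ) ^ 2 ≤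
      ((S ×ˢ S).filter fun p => π p.1 = π p.2).card := by
    intro n
    rw [sq, ← Nat.cast_mul, ← Finset.card_product, Nat.cast_le]
    refine Finset.card_le_card fun p hp => ?_
    simp only [Finset.mem_product, Finset.mem_filter] at hp ⊢
    exact ⟨⟨hp.1.1, hp.2.1⟩, hp.1.2.trans hp.2.2.symm⟩
  have hN : (S.card : ℝ) ≤ (S.filter fun x => π x = π x₀).card +
      (S.filter fun x => π x = π x₁).card + C * s := by
    have h1 := (Finset.card_le_card hsub).trans
      ((Finset.card_union_le _ _).trans (Nat.add_le_add_right (Finset.card_union_le _ _) _))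
    have h2 : (S.card : ℝ) ≤ _ := Nat.cast_le.mpr h1
    push_cast at h2
    linarith
  have h0 := hpart (π x₀)
  have h1 := hpart (π x₁)
  set A : ℝ := ((S.filter fun x => π x = π x₀).card : ℝ)
  set B : ℝ := ((S.filter fun x => π x = π x₁).card : ℝ)
  have hN0 : (0 : ℝ) ≤ S.card := Nat.cast_nonneg _
  -- With N the cardinality, N ≤ A + B + Cs, N(A + B) ≤ N²/2 + (A + B)²/2 and (A + B)² ≤ 2A² + 2B².
  nlinarith [sq_nonneg ((S.card : ℝ) - (A + B)), sq_nonneg (A - B),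
    mul_le_mul_of_nonneg_left hN hN0]

/-- Apply the diameter bound to each fibre of `q` and add up; the fibres partition `S`, and
same-cell pairs from distinct fibres are distinct. -/
theorem card_same_cell_le {S : Finset ℝ} {a : ℤ → ℝ} (ha : Monotone a) {π : ℝ → ℤ}
    (hπ : ∀ x, a (π x) < x ∧ x ≤ a (π x + 1)) {C : ℝ} (hC0 : 0 ≤ C)
    (hC : ∀ n, ((S.filter fun x => π x = n).card : ℝ) ≤ C * (a (n + 1) - a n))
    {s : ℝ} {q : ℝ → ℤ} (hq : ∀ x y, q x = q y → |x - y| ≤ s) :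
    (((S ×ˢ S).filter fun p => q p.1 = q p.2).card : ℝ) ≤ 2 * C * s * S.card
      + 4 * ((S ×ˢ S).filter fun p => π p.1 = π p.2 ∧ |p.1 - p.2| ≤ s).card := by
  classical
  have h1 : ((S ×ˢ S).filter fun p => q p.1 = q p.2).card =
      ∑ v ∈ S.image q, (S.filter fun x => q x = v).card ^ 2 := by
    rw [Finset.card_eq_sum_card_fiberwise (f := fun p => q p.1) (t := S.image q)]
    · refine Finset.sum_congr rfl fun v _ => ?_
      rw [sq, ← Finset.card_product]
      congr 1
      ext p
      simp only [Finset.mem_product, Finset.mem_filter]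
      constructor
      · rintro ⟨⟨⟨h1, h2⟩, h3⟩, h4⟩
        exact ⟨⟨h1, h4⟩, h2, h3 ▸ h4⟩
      · rintro ⟨⟨h1, h2⟩, h3, h4⟩
        exact ⟨⟨⟨h1, h3⟩, h2.trans h4.symm⟩, h2⟩
    · intro p hp
      simp only [Finset.coe_filter, Finset.mem_product, Set.mem_ofPred_eq] at hp
      exact Finset.mem_coe.mpr (Finset.mem_image_of_mem q hp.1.1)
  have h2 : S.card = ∑ v ∈ S.image q, (S.filter fun x => q x = v).card :=
    Finset.card_eq_sum_card_fiberwise fun x hx => Finset.mem_coe.mpr (Finset.mem_image_of_mem q hx)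
  have h3 : ∑ v ∈ S.image q, (((S.filter fun x => q x = v) ×ˢ (S.filter fun x => q x = v)).filter
      fun p => π p.1 = π p.2).card ≤
      ((S ×ˢ S).filter fun p => π p.1 = π p.2 ∧ |p.1 - p.2| ≤ s).card := by
    rw [← Finset.card_biUnion]
    · refine Finset.card_le_card fun p hp => ?_
      simp only [Finset.mem_biUnion, Finset.mem_filter, Finset.mem_product] at hp ⊢
      obtain ⟨v, -, ⟨⟨h1, h2⟩, h3, h4⟩, h5⟩ := hp
      exact ⟨⟨h1, h3⟩, h5, hq _ _ (h2.trans h4.symm)⟩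
    · intro v _ w _ hvw
      rw [Function.onFun, Finset.disjoint_left]
      intro p hp hp'
      simp only [Finset.mem_filter, Finset.mem_product] at hp hp'
      exact hvw (hp.1.1.2.symm.trans hp'.1.1.2)
  have h4 : ∀ v ∈ S.image q, (((S.filter fun x => q x = v).card : ℝ)) ^ 2 ≤
      2 * C * s * (S.filter fun x => q x = v).card + 4 *
      (((S.filter fun x => q x = v) ×ˢ (S.filter fun x => q x = v)).filter
      fun p => π p.1 = π p.2).card := by
    intro v _
    refine card_sq_le_of_diam ha hπ hC0 (fun n => le_trans ?_ (hC n)) ?_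
    · exact_mod_cast Finset.card_le_card (Finset.filter_subset_filter _ (Finset.filter_subset _ _))
    · intro x hx y hy
      simp only [Finset.mem_filter] at hx hy
      exact hq _ _ (hx.2.trans hy.2.symm)
  have h5 := Finset.sum_le_sum h4
  rw [Finset.sum_add_distrib, ← Finset.mul_sum, ← Finset.mul_sum] at h5
  have h2' : (S.card : ℝ) = ∑ v ∈ S.image q, ((S.filter fun x => q x = v).card : ℝ) := by
    exact_mod_cast h2
  rw [h1, h2']
  push_cast
  refine h5.trans ?_
  have h3' := (Nat.cast_le (α := ℝ)).mpr h3
  push_cast at h3'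
  linarith

/-- Two grids of mesh `2 * r`, shifted by half a mesh, suffice: any pair at distance at most `r`
shares a cell in one of them. -/
theorem card_near_le {S : Finset ℝ} {a : ℤ → ℝ} (ha : Monotone a) {π : ℝ → ℤ}
    (hπ : ∀ x, a (π x) < x ∧ x ≤ a (π x + 1)) {C : ℝ} (hC0 : 0 ≤ C)
    (hC : ∀ n, ((S.filter fun x => π x = n).card : ℝ) ≤ C * (a (n + 1) - a n))
    {r : ℝ} (hr : 0 < r) :
    (((S ×ˢ S).filter fun p => |p.1 - p.2| ≤ r).card : ℝ) ≤ 8 * C * r * S.card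
      + 8 * ((S ×ˢ S).filter fun p => π p.1 = π p.2 ∧ |p.1 - p.2| ≤ 2 * r).card := by
  classical
  have hcell : ∀ θ : ℝ, ∀ x y : ℝ, ⌊x / (2 * r) + θ⌋ = ⌊y / (2 * r) + θ⌋ → |x - y| ≤ 2 * r := by
    intro θ x y h
    have := (Int.abs_sub_lt_one_of_floor_eq_floor h).le
    rw [add_sub_add_right_eq_sub, ← sub_div, abs_div, abs_of_pos (by positivity : 0 < 2 * r),
      div_le_one (by positivity)] at this
    exact this
  have h0 := card_same_cell_le ha hπ hC0 hC (hcell 0)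
  have h1 := card_same_cell_le ha hπ hC0 hC (hcell (1 / 2))
  have hsub : ((S ×ˢ S).filter fun p => |p.1 - p.2| ≤ r) ⊆
      ((S ×ˢ S).filter fun p => ⌊p.1 / (2 * r) + 0⌋ = ⌊p.2 / (2 * r) + 0⌋) ∪
      ((S ×ˢ S).filter fun p => ⌊p.1 / (2 * r) + 1 / 2⌋ = ⌊p.2 / (2 * r) + 1 / 2⌋) := by
    rintro ⟨x, y⟩ hp
    simp only [Finset.mem_filter, Finset.mem_union] at hp ⊢
    obtain ⟨hS, hp⟩ := hp
    suffices h : ⌊x / (2 * r) + 0⌋ = ⌊y / (2 * r) + 0⌋ ∨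
        ⌊x / (2 * r) + 1 / 2⌋ = ⌊y / (2 * r) + 1 / 2⌋ from
      h.imp (fun h => ⟨hS, h⟩) (fun h => ⟨hS, h⟩)
    have hd : |x / (2 * r) - y / (2 * r)| ≤ 1 / 2 := by
      rw [← sub_div, abs_div, abs_of_pos (by positivity : 0 < 2 * r), div_le_iff₀ (by positivity)]
      linarith
    generalize x / (2 * r) = u at hd ⊢
    generalize y / (2 * r) = v at hd ⊢
    rw [abs_le] at hd
    -- If both grids separate u and v, an integer and a half-integer lie in the half-open interval
    -- between them, which forces a distance greater than 1/2.
    by_contra! h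
    obtain ⟨h1, h2⟩ := h
    have a1 := Int.floor_le (u + 0)
    have a2 := Int.lt_floor_add_one (u + 0)
    have a3 := Int.floor_le (v + 0)
    have a4 := Int.lt_floor_add_one (v + 0)
    have a5 := Int.floor_le (u + 1 / 2)
    have a6 := Int.lt_floor_add_one (u + 1 / 2)
    have a7 := Int.floor_le (v + 1 / 2)
    have a8 := Int.lt_floor_add_one (v + 1 / 2)
    generalize ⌊u + 0⌋ = A at *
    generalize ⌊v + 0⌋ = B at *
    generalize ⌊u + 1 / 2⌋ = A' at *
    generalize ⌊v + 1 / 2⌋ = B' at *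
    rcases lt_or_gt_of_ne h1 with h1 | h1 <;> rcases lt_or_gt_of_ne h2 with h2 | h2
    · have e1 : (A : ℝ) + 1 ≤ B := by exact_mod_cast h1
      have e2 : (A' : ℝ) + 1 ≤ B' := by exact_mod_cast h2
      have : B ≤ A' := by
        by_contra! hh
        have : (A' : ℝ) + 1 ≤ B := by exact_mod_cast hh
        linarith
      have : A' < B := by
        have : (A' : ℝ) < B := by linarith
        exact_mod_cast this
      omega
    · have e1 : (A : ℝ) + 1 ≤ B := by exact_mod_cast h1
      have e2 : (B' : ℝ) + 1 ≤ A' := by exact_mod_cast h2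
      linarith
    · have e1 : (B : ℝ) + 1 ≤ A := by exact_mod_cast h1
      have e2 : (A' : ℝ) + 1 ≤ B' := by exact_mod_cast h2
      linarith
    · have e1 : (B : ℝ) + 1 ≤ A := by exact_mod_cast h1
      have e2 : (B' : ℝ) + 1 ≤ A' := by exact_mod_cast h2
      have : A ≤ B' := by
        by_contra! hh
        have : (B' : ℝ) + 1 ≤ A := by exact_mod_cast hh
        linarith
      have : B' < A := by
        have : (B' : ℝ) < A := by linarith
        exact_mod_cast this
      omega
  have h2 := (Nat.cast_le (α := ℝ)).mpr ((Finset.card_le_card hsub).trans (Finset.card_union_le _ _))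
  push_cast at h2
  linarith

/-! ### Energy of a block as a sum over dyadic scales -/

/-- Together with `card_scales_le`, this trades a logarithm for a number of dyadic scales, using 1/2
< log 2 < 1. The upper bound needs `J` to be large enough for `u`; the reverse one does not. -/
theorem log_le_card_scales {u : ℝ} (hu : 0 < u) (J : ℕ) (h : u ≤ 2 ^ J) :
    Real.log u ≤ ((Finset.range J).filter fun j => (2 : ℝ) ^ j ≤ u).card := by
  induction J with
  | zero => simpa using Real.log_nonpos hu.le (by simpa using h)
  | succ J ih =>
    rcases le_or_gt u (2 ^ J) with h' | h'
    · refine (ih h').trans ?_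
      exact_mod_cast Finset.card_le_card (Finset.filter_subset_filter _
        (Finset.range_subset_range.mpr J.le_succ))
    · rw [Finset.filter_true_of_mem, Finset.card_range]
      · calc Real.log u ≤ Real.log (2 ^ (J + 1)) := Real.log_le_log hu h
          _ = (J + 1 : ℕ) * Real.log 2 := Real.log_pow _ _
          _ ≤ (J + 1 : ℕ) * 1 := by
            gcongr
            linarith [Real.log_two_lt_d9]
          _ = _ := mul_one _
      · intro j hj
        refine le_trans ?_ h'.le
        exact pow_le_pow_right₀ one_le_two (by simpa [Nat.lt_succ_iff] using hj)

theorem card_scales_le {u : ℝ} (hu : 1 ≤ u) (J : ℕ) :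
    (((Finset.range J).filter fun j => (2 : ℝ) ^ j ≤ u).card : ℝ) ≤ 1 + 2 * Real.log u := by
  have hlog : 0 ≤ Real.log u := Real.log_nonneg hu
  have hsub : ((Finset.range J).filter fun j => (2 : ℝ) ^ j ≤ u) ⊆
      Finset.range (⌊2 * Real.log u⌋₊ + 1) := by
    intro j hj
    simp only [Finset.mem_filter, Finset.mem_range] at hj ⊢
    rw [Nat.lt_succ_iff, Nat.le_floor_iff (by positivity)]
    have := Real.log_le_log (by positivity) hj.2
    rw [Real.log_pow] at this
    nlinarith [Real.log_two_gt_d9, (Nat.cast_nonneg j : (0 : ℝ) ≤ j)]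
  have h1 := Finset.card_le_card hsub
  rw [Finset.card_range] at h1
  have h2 : (((Finset.range J).filter fun j => (2 : ℝ) ^ j ≤ u).card : ℝ) ≤
    (⌊2 * Real.log u⌋₊ + 1 : ℕ) := Nat.cast_le.mpr h1
  have h3 := Nat.floor_le (show 0 ≤ 2 * Real.log u by positivity)
  push_cast at h2
  linarith


/-- A cross pair contributes at most the number of scales `j < J` with distance at most `R / 2 ^ j`.
At each scale `card_near_le` passes to same-cell pairs, with errors summing geometrically; summing
the scales back gives at most 3 + 2 log per same-cell pair. This yields 17 = 1 + 8 · 2 and 57 = 16 +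
8 · 3 + 17. -/
theorem logEnergy_le {S : Finset ℝ} {a : ℤ → ℝ} (ha : Monotone a) {π : ℝ → ℤ}
    (hπ : ∀ x, a (π x) < x ∧ x ≤ a (π x + 1)) {C : ℝ} (hC0 : 0 ≤ C)
    (hC : ∀ n, ((S.filter fun x => π x = n).card : ℝ) ≤ C * len a n)
    {R : ℝ} (hR : 0 < R) (hlen : ∀ x ∈ S, len a (π x) ≤ R)
    (hd : ∀ x ∈ S, ∀ y ∈ S, |x - y| ≤ R) {J : ℕ}
    (hJ : ∀ x ∈ S, ∀ y ∈ S, π x ≠ π y → R / |x - y| ≤ 2 ^ J) :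
    logEnergy R S ≤ 17 * ∑ n ∈ S.image π, logEnergy (len a n) (S.filter fun x => π x = n)
      + 57 * C * R * S.card + 8 * J * S.card := by
  classical
  have hN0 : (0 : ℝ) ≤ S.card := Nat.cast_nonneg _
  have hcard : (S.card : ℝ) = ∑ n ∈ S.image π, ((S.filter fun x => π x = n).card : ℝ) := by
    exact_mod_cast Finset.card_eq_sum_card_fiberwise
      fun x hx => Finset.mem_coe.mpr (Finset.mem_image_of_mem π hx)
  have hlen0 : ∀ n ∈ S.image π, 0 < len a n ∧ len a n ≤ R := by
    intro n hn
    obtain ⟨x, hx, rfl⟩ := Finset.mem_image.mp hn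
    refine ⟨?_, hlen x hx⟩
    have := hπ x
    unfold len
    linarith
  have hsame : ∀ f : ℝ × ℝ → ℝ, ∑ p ∈ S.offDiag with π p.1 = π p.2, f p =
      ∑ n ∈ S.image π, ∑ p ∈ (S.filter fun x => π x = n).offDiag, f p := by
    intro f
    rw [← Finset.sum_fiberwise_of_maps_to (g := fun p => π p.1) (t := S.image π)]
    · refine Finset.sum_congr rfl fun n _ => Finset.sum_congr ?_ fun _ _ => rfl
      ext p
      simp only [Finset.mem_filter, Finset.mem_offDiag]
      constructor
      · rintro ⟨⟨⟨h1, h2, h3⟩, h4⟩, h5⟩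
        exact ⟨⟨h1, h5⟩, ⟨h2, h4 ▸ h5⟩, h3⟩
      · rintro ⟨⟨h1, h5⟩, ⟨h2, h4⟩, h3⟩
        exact ⟨⟨⟨h1, h2, h3⟩, h5.trans h4.symm⟩, h5⟩
    · intro p hp
      simp only [Finset.mem_filter, Finset.mem_offDiag] at hp
      exact Finset.mem_image_of_mem π hp.1.1
  have hoff : ∀ n ∈ S.image π, ((S.filter fun x => π x = n).offDiag.card : ℝ) ≤
      (S.filter fun x => π x = n).card * (C * len a n) := by
    intro n _
    refine le_trans ?_ (mul_le_mul_of_nonneg_left (hC n) (Nat.cast_nonneg _))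
    rw [Finset.offDiag_card]
    exact_mod_cast Nat.sub_le _ _
  have hcount : ((S.offDiag.filter fun p => π p.1 = π p.2).card : ℝ) ≤ C * R * S.card := by
    have h := hsame fun _ => 1
    simp only [Finset.sum_const, nsmul_eq_mul, mul_one] at h
    rw [h, hcard, Finset.mul_sum]
    refine Finset.sum_le_sum fun n hn => (hoff n hn).trans ?_
    rw [mul_comm]
    have := (hlen0 n hn).2
    gcongr
  have hB : ∑ p ∈ S.offDiag with π p.1 = π p.2, Real.log (R / |p.1 - p.2|) ≤
      ∑ n ∈ S.image π, logEnergy (len a n) (S.filter fun x => π x = n) + C * R * S.card := by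
    rw [hsame, hcard, Finset.mul_sum, ← Finset.sum_add_distrib]
    refine Finset.sum_le_sum fun n hn => ?_
    obtain ⟨hl, hlR⟩ := hlen0 n hn
    have h1 : ∀ p ∈ (S.filter fun x => π x = n).offDiag, Real.log (R / |p.1 - p.2|) =
        Real.log (len a n / |p.1 - p.2|) + Real.log (R / len a n) := by
      intro p hp
      rw [Finset.mem_offDiag] at hp
      have : 0 < |p.1 - p.2| := abs_pos.mpr (sub_ne_zero.mpr hp.2.2)
      rw [← Real.log_mul (by positivity) (by positivity)]
      congr 1
      field_simp
    rw [Finset.sum_congr rfl h1, Finset.sum_add_distrib, Finset.sum_const, nsmul_eq_mul]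
    refine add_le_add le_rfl ?_
    -- This crude bound is affordable: a cell has at most its cardinality times `C * len a n` pairs,
    -- so its length cancels.
    have hlog : Real.log (R / len a n) ≤ R / len a n := Real.log_le_self (by positivity)
    calc _ ≤ (S.filter fun x => π x = n).offDiag.card * (R / len a n) := by gcongr
      _ ≤ (S.filter fun x => π x = n).card * (C * len a n) * (R / len a n) := by
        gcongr
        exact hoff n hn
      _ = _ := by field_simp
  have hposd : ∀ p ∈ S.offDiag, 0 < |p.1 - p.2| ∧ |p.1 - p.2| ≤ R := by
    intro p hp
    rw [Finset.mem_offDiag] at hp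
    exact ⟨abs_pos.mpr (sub_ne_zero.mpr hp.2.2), hd _ hp.1 _ hp.2.1⟩
  -- The diagonal pairs are counted at every scale; they alone produce the term with `J`.
  have hdiag : ∑ j ∈ Finset.range J, (((S ×ˢ S).filter fun p => π p.1 = π p.2 ∧
      |p.1 - p.2| ≤ 2 * (R / 2 ^ j)).card : ℝ) ≤ J * S.card +
      ∑ p ∈ S.offDiag with π p.1 = π p.2, (3 + 2 * Real.log (R / |p.1 - p.2|)) := by
    calc _ ≤ ∑ j ∈ Finset.range J, ((S.card : ℝ) + ∑ p ∈ S.offDiag with π p.1 = π p.2,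
          if (2 : ℝ) ^ j ≤ 2 * R / |p.1 - p.2| then (1 : ℝ) else 0) := by
          refine Finset.sum_le_sum fun j _ => ?_
          rw [Finset.sum_boole, Finset.filter_filter, ← S.diag_card]
          norm_cast
          refine (Finset.card_le_card fun p hp => ?_).trans (Finset.card_union_le _ _)
          simp only [Finset.mem_filter, Finset.mem_union, Finset.mem_diag, Finset.mem_offDiag,
            Finset.mem_product] at hp ⊢
          by_cases h : p.1 = p.2
          · exact Or.inl ⟨hp.1.1, h⟩
          · refine Or.inr ⟨⟨hp.1.1, hp.1.2, h⟩, hp.2.1, ?_⟩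
            have h0 : 0 < |p.1 - p.2| := abs_pos.mpr (sub_ne_zero.mpr h)
            have h2 := hp.2.2
            rw [← mul_div_assoc, le_div_iff₀ (by positivity)] at h2
            rw [le_div_iff₀ h0]
            linarith
      _ = J * S.card + ∑ p ∈ S.offDiag with π p.1 = π p.2,
          (((Finset.range J).filter fun j => (2 : ℝ) ^ j ≤ 2 * R / |p.1 - p.2|).card : ℝ) := by
          rw [Finset.sum_add_distrib, Finset.sum_comm]
          simp
      _ ≤ _ := by
          gcongr with p hp
          obtain ⟨h0, h1⟩ := hposd p (Finset.mem_filter.mp hp).1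
          have h2 : 1 ≤ R / |p.1 - p.2| := (one_le_div h0).mpr h1
          refine (card_scales_le ?_ J).trans ?_
          · rw [mul_div_assoc]
            linarith
          · rw [mul_div_assoc, Real.log_mul two_ne_zero (by positivity)]
            linarith [Real.log_two_lt_d9]
  have hgeom : ∑ j ∈ Finset.range J, R / 2 ^ j ≤ 2 * R := by
    have := sum_geometric_two_le J
    calc ∑ j ∈ Finset.range J, R / 2 ^ j = R * ∑ j ∈ Finset.range J, (1 / (2 : ℝ)) ^ j := by
          rw [Finset.mul_sum]
          simp [div_eq_mul_inv]
      _ ≤ 2 * R := by nlinarith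
  have hcross : ∑ p ∈ S.offDiag with ¬ π p.1 = π p.2, Real.log (R / |p.1 - p.2|) ≤
      16 * C * R * S.card + 8 * (J * S.card +
        ∑ p ∈ S.offDiag with π p.1 = π p.2, (3 + 2 * Real.log (R / |p.1 - p.2|))) := by
    calc _ ≤ ∑ p ∈ S.offDiag with ¬ π p.1 = π p.2, (((Finset.range J).filter
            fun j => (2 : ℝ) ^ j ≤ R / |p.1 - p.2|).card : ℝ) := by
          refine Finset.sum_le_sum fun p hp => ?_
          rw [Finset.mem_filter] at hp
          have h := hposd p hp.1
          have hp' := Finset.mem_offDiag.mp hp.1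
          exact log_le_card_scales (div_pos hR h.1) J (hJ _ hp'.1 _ hp'.2.1 hp.2)
      _ = ∑ j ∈ Finset.range J, ∑ p ∈ S.offDiag with ¬ π p.1 = π p.2,
            if (2 : ℝ) ^ j ≤ R / |p.1 - p.2| then (1 : ℝ) else 0 := by
          rw [Finset.sum_comm]
          simp
      _ ≤ ∑ j ∈ Finset.range J, (8 * C * (R / 2 ^ j) * S.card + 8 * ((S ×ˢ S).filter
            fun p => π p.1 = π p.2 ∧ |p.1 - p.2| ≤ 2 * (R / 2 ^ j)).card) := by
          refine Finset.sum_le_sum fun j _ => ?_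
          refine le_trans ?_ (card_near_le ha hπ hC0 hC (by positivity))
          rw [Finset.sum_boole, Nat.cast_le]
          refine Finset.card_le_card fun p hp => ?_
          simp only [Finset.mem_filter, Finset.mem_offDiag, Finset.mem_product] at hp ⊢
          have h0 : 0 < |p.1 - p.2| := abs_pos.mpr (sub_ne_zero.mpr hp.1.1.2.2)
          refine ⟨⟨hp.1.1.1, hp.1.1.2.1⟩, ?_⟩
          have := hp.2
          rw [le_div_iff₀ h0] at this
          rw [le_div_iff₀ (by positivity)]
          linarith
      _ = 8 * C * (∑ j ∈ Finset.range J, R / 2 ^ j) * S.card + 8 * ∑ j ∈ Finset.range J,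
            (((S ×ˢ S).filter fun p => π p.1 = π p.2 ∧
              |p.1 - p.2| ≤ 2 * (R / 2 ^ j)).card : ℝ) := by
          rw [Finset.sum_add_distrib, Finset.mul_sum, Finset.mul_sum, Finset.sum_mul]
      _ ≤ 8 * C * (2 * R) * S.card + 8 * (J * S.card +
            ∑ p ∈ S.offDiag with π p.1 = π p.2, (3 + 2 * Real.log (R / |p.1 - p.2|))) := by
          gcongr
      _ = _ := by ring
  rw [Finset.sum_add_distrib, Finset.sum_const, nsmul_eq_mul, ← Finset.mul_sum] at hcross
  have hsplit := Finset.sum_filter_add_sum_filter_not S.offDiag (fun p => π p.1 = π p.2)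
    (fun p => Real.log (R / |p.1 - p.2|))
  unfold logEnergy at hB ⊢
  rw [← hsplit]
  linarith

/-! ### Elementary properties of the energy -/

theorem logEnergy_nonneg {R : ℝ} {S : Finset ℝ} (hd : ∀ x ∈ S, ∀ y ∈ S, |x - y| ≤ R) :
    0 ≤ logEnergy R S := by
  refine Finset.sum_nonneg fun p hp => ?_
  rw [Finset.mem_offDiag] at hp
  exact Real.log_nonneg ((one_le_div (abs_pos.mpr (sub_ne_zero.mpr hp.2.2))).mpr
    (hd _ hp.1 _ hp.2.1))

theorem logEnergy_mono {R : ℝ} {S T : Finset ℝ} (h : S ⊆ T)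
    (hd : ∀ x ∈ T, ∀ y ∈ T, |x - y| ≤ R) : logEnergy R S ≤ logEnergy R T := by
  refine Finset.sum_le_sum_of_subset_of_nonneg (Finset.offDiag_mono h) fun p hp _ => ?_
  rw [Finset.mem_offDiag] at hp
  exact Real.log_nonneg ((one_le_div (abs_pos.mpr (sub_ne_zero.mpr hp.2.2))).mpr
    (hd _ hp.1 _ hp.2.1))

/-- The numerator in the energy condition, written through `logEnergy`. -/
theorem sq_mul_log_sub_energy (S : Finset ℝ) {R : ℝ} (hR : 0 < R) :
    (S.card : ℝ) ^ 2 * Real.log R - energy (S : Set ℝ) =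
      logEnergy R S + S.card * Real.log R := by
  classical
  have h1 : energy (S : Set ℝ) = ∑ p ∈ S.offDiag, Real.log |p.1 - p.2| := by
    unfold energy
    rw [← Finset.coe_offDiag, finsum_mem_coe_finset]
  have h2 : logEnergy R S = S.offDiag.card * Real.log R - energy (S : Set ℝ) := by
    rw [h1, logEnergy, ← nsmul_eq_mul, ← Finset.sum_const, ← Finset.sum_sub_distrib]
    refine Finset.sum_congr rfl fun p hp => ?_
    rw [Finset.mem_offDiag] at hp
    exact Real.log_div hR.ne' (abs_pos.mpr (sub_ne_zero.mpr hp.2.2)).ne'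
  have h3 : (S.offDiag.card : ℝ) + S.card = (S.card : ℝ) ^ 2 := by
    have : S.offDiag.card + S.card = S.card * S.card := by
      rw [Finset.offDiag_card]
      exact Nat.sub_add_cancel (Nat.le_mul_self _)
    rw [sq]
    exact_mod_cast this
  rw [h2, ← h3]
  ring

/-- A set of points at mutual distances at most `r` whose energy is small has few points. -/
theorem card_le_of_logEnergy {S : Finset ℝ} {R T μ : ℝ} (hT : 0 < T) (hμ : 0 < μ)
    (hr : ∀ x ∈ S, ∀ y ∈ S, x ≠ y → T ≤ Real.log (R / |x - y|)) :
    (S.card : ℝ) ≤ 1 + μ + logEnergy R S / (T * μ) := by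
  classical
  have h1 : (S.offDiag.card : ℝ) * T ≤ logEnergy R S := by
    rw [← nsmul_eq_mul, ← Finset.sum_const]
    refine Finset.sum_le_sum fun p hp => ?_
    rw [Finset.mem_offDiag] at hp
    exact hr _ hp.1 _ hp.2.1 hp.2.2
  have h3 : (S.offDiag.card : ℝ) + S.card = (S.card : ℝ) ^ 2 := by
    have : S.offDiag.card + S.card = S.card * S.card := by
      rw [Finset.offDiag_card]
      exact Nat.sub_add_cancel (Nat.le_mul_self _)
    rw [sq]
    exact_mod_cast this
  have h4 : (0 : ℝ) ≤ S.offDiag.card := Nat.cast_nonneg _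
  have h5 : 0 ≤ logEnergy R S := le_trans (by positivity) h1
  rcases le_or_gt (S.card : ℝ) (1 + μ) with h | h
  · have : 0 ≤ logEnergy R S / (T * μ) := by positivity
    linarith
  · have : (S.card : ℝ) ≤ logEnergy R S / (T * μ) := by
      rw [le_div_iff₀ (by positivity)]
      refine le_trans ?_ h1
      -- There are N(N - 1) ordered pairs, each costing at least `T`, and N - 1 exceeds `μ` in this
      -- case.
      have e : (S.offDiag.card : ℝ) = S.card * (S.card - 1) := by linarith
      rw [e]
      have : (S.card : ℝ) * μ ≤ S.card * (S.card - 1) := by gcongr; linarith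
      nlinarith
    linarith


/-! ### Greedy coarsening on a half-line, and slowly growing multipliers -/

theorem injective_of_ne_of_lt {α β : Type*} [LinearOrder α] {f : α → β}
    (h : ∀ x y, x < y → f x ≠ f y) : Function.Injective f := by
  intro x y e
  by_contra hne
  rcases lt_or_gt_of_ne hne with hlt | hlt
  · exact h _ _ hlt e
  · exact h _ _ hlt e.symm

/-- Here `σ n` is the cell of a second partition containing the endpoint `α n`, and `h` majorizes
the cell lengths. The next endpoint is the first one whose distance from the current one dominates
`h` at both. By minimality a new interval is at most its last old interval plus two values of `h`,
and each of the three contributions is square-summable. -/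
theorem exists_coarsening_nat {α : ℕ → ℝ} (hα : StrictMono α) (hα0 : α 0 = 0)
    (hαt : Tendsto α atTop atTop)
    (hα2 : Summable fun n => (α (n + 1) - α n) ^ 2 / (1 + α n ^ 2))
    {σ : ℕ → ℤ} (hσ : ∀ l m n, l ≤ m → m ≤ n → σ l = σ n → σ m = σ l)
    (hσt : Tendsto σ atTop cofinite) {h w : ℤ → ℝ} (hh0 : ∀ j, 0 < h j) (hw : ∀ j, 0 < w j)
    (hσh : ∀ m n, m ≤ n → σ m = σ n → α n - α m < h (σ m))
    (hσw : ∀ n, w (σ n) ≤ 1 + α n ^ 2) (hs : Summable fun j => h j ^ 2 / w j) :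
    ∃ k : ℕ → ℕ, StrictMono k ∧ k 0 = 0 ∧
      (∀ m, h (σ (k m)) ≤ α (k (m + 1)) - α (k m)) ∧
      (∀ m, h (σ (k (m + 1))) ≤ α (k (m + 1)) - α (k m)) ∧
      Summable fun m => (α (k (m + 1)) - α (k m)) ^ 2 / (1 + α (k m) ^ 2) := by
  classical
  have hαnn : ∀ n, 0 ≤ α n := fun n => hα0 ▸ hα.monotone (Nat.zero_le n)
  -- Eventually h² < (1 + α²)/32 ≤ α²/16. So the greedy step always terminates, and weights at both
  -- ends of a new interval are comparable.
  have hsmall : ∀ᶠ n in atTop, h (σ n) ≤ α n / 4 := by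
    have h1 := (hs.tendsto_cofinite_zero.comp hσt).eventually
      (gt_mem_nhds (show (0 : ℝ) < 1 / 32 by norm_num))
    filter_upwards [h1, hαt.eventually_ge_atTop 1] with n hn h1n
    rw [Function.comp_apply, div_lt_iff₀ (hw _)] at hn
    have := hσw n
    have := hh0 (σ n)
    by_contra! hc
    nlinarith
  have hex : ∀ p, ∃ n, p < n ∧ h (σ p) ≤ α n - α p ∧ h (σ n) ≤ α n - α p := by
    intro p
    obtain ⟨n, h1, h2, h3, h4⟩ := (hsmall.and ((eventually_gt_atTop p).and
      ((hαt.eventually_ge_atTop (h (σ p) + α p)).and (hαt.eventually_ge_atTop (2 * α p))))).exists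
    refine ⟨n, h2, by linarith, ?_⟩
    have := hαnn n
    linarith
  set next : ℕ → ℕ := fun p => Nat.find (hex p)
  have hnext : ∀ p, p < next p ∧ h (σ p) ≤ α (next p) - α p ∧ h (σ (next p)) ≤ α (next p) - α p :=
    fun p => Nat.find_spec (hex p)
  have hmin : ∀ p n, p < n → n < next p → α n - α p ≤ h (σ p) ∨ α n - α p ≤ h (σ n) := by
    intro p n h1 h2
    have := Nat.find_min (hex p) h2
    by_contra! hc
    exact this ⟨h1, hc.1.le, hc.2.le⟩
  set k : ℕ → ℕ := fun m => next^[m] 0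
  have hk : ∀ m, k (m + 1) = next (k m) := fun m => Function.iterate_succ_apply' next m 0
  have hkm : StrictMono k := strictMono_nat_of_lt_succ fun m => by
    rw [hk]; exact (hnext _).1
  have hk1 : ∀ m, h (σ (k m)) ≤ α (k (m + 1)) - α (k m) := fun m => by
    rw [hk]; exact (hnext _).2.1
  have hk2 : ∀ m, h (σ (k (m + 1))) ≤ α (k (m + 1)) - α (k m) := fun m => by
    rw [hk]; exact (hnext _).2.2
  have hne : ∀ m, σ (k m) ≠ σ (k (m + 1)) := by
    intro m e
    have := hσh _ _ (hkm m.lt_succ_self).le e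
    linarith [hk1 m]
  refine ⟨k, hkm, rfl, hk1, hk2, ?_⟩
  set ν : ℕ → ℕ := fun m => k (m + 1) - 1
  have hν : ∀ m, k m ≤ ν m ∧ ν m + 1 = k (m + 1) := by
    intro m
    have := hkm m.lt_succ_self
    simp only [Nat.succ_eq_add_one] at this
    simp only [ν]
    omega
  have hνm : StrictMono ν := strictMono_nat_of_lt_succ fun m => by
    have := (hν m).2
    have := (hν (m + 1)).1
    omega
  have hb1 : ∀ m, α (ν m) - α (k m) ≤ h (σ (k m)) ∨ α (ν m) - α (k m) ≤ h (σ (ν m)) := by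
    intro m
    rcases (hν m).1.eq_or_lt with e | e
    · left
      rw [← e, sub_self]
      exact (hh0 _).le
    · refine hmin _ _ e ?_
      rw [← hk]
      have := (hν m).2
      omega
  have hdbl : ∀ᶠ m in atTop, 1 + α (ν m) ^ 2 ≤ 4 * (1 + α (k m) ^ 2) := by
    filter_upwards [hkm.tendsto_atTop.eventually hsmall, hνm.tendsto_atTop.eventually hsmall]
      with m h1 h2
    have hle := hα.monotone (hν m).1
    have hnn := hαnn (k m)
    have : α (ν m) ≤ 2 * α (k m) := by
      rcases hb1 m with h3 | h3 <;> linarith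
    nlinarith
  have hs1 : Summable fun m => (α (ν m + 1) - α (ν m)) ^ 2 / (1 + α (ν m) ^ 2) :=
    hα2.comp_injective hνm.injective
  have hs2 : Summable fun m => h (σ (k m)) ^ 2 / w (σ (k m)) := by
    refine hs.comp_injective (i := fun m => σ (k m)) (injective_of_ne_of_lt fun m m' hmm e => ?_)
    exact hne m (hσ _ _ _ (hkm m.lt_succ_self).le (hkm.monotone hmm) e).symm
  -- Consecutive `ν m` may share a cell, but two steps apart they enclose `k (m + 1)` and `k (m +
  -- 2)`, which lie in different cells. Hence the split into even and odd indices below.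
  have hsep : ∀ m m', m + 2 ≤ m' → σ (ν m) ≠ σ (ν m') := by
    intro m m' hmm e
    have h1 : ν m ≤ k (m + 1) := by have := (hν m).2; omega
    have h2 : k (m + 2) ≤ ν m' := (hkm.monotone hmm).trans (hν m').1
    have h3 : k (m + 1) ≤ k (m + 2) := hkm.monotone (by omega)
    have e1 := hσ _ _ _ h1 (h3.trans h2) e
    have e2 := hσ _ _ _ (h1.trans h3) h2 e
    exact hne (m + 1) (e1.trans e2.symm)
  have hs3 : Summable fun m => h (σ (ν m)) ^ 2 / w (σ (ν m)) := by
    refine (HasSum.even_add_odd (Summable.hasSum ?_) (Summable.hasSum ?_)).summable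
    · exact hs.comp_injective (i := fun m => σ (ν (2 * m)))
        (injective_of_ne_of_lt fun m m' hmm => hsep _ _ (by omega))
    · exact hs.comp_injective (i := fun m => σ (ν (2 * m + 1)))
        (injective_of_ne_of_lt fun m m' hmm => hsep _ _ (by omega))
  refine Summable.of_norm_bounded_eventually_nat
    (((hs1.mul_left 12).add (hs2.mul_left 3)).add (hs3.mul_left 12)) ?_
  filter_upwards [hdbl] with m hm
  rw [Real.norm_of_nonneg (by positivity)]
  have hP : 0 < 1 + α (k m) ^ 2 := by positivity
  have hQ : 0 < 1 + α (ν m) ^ 2 := by positivity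
  have hb : α (k (m + 1)) - α (k m) ≤ (α (ν m + 1) - α (ν m)) + h (σ (k m)) + h (σ (ν m)) := by
    rw [(hν m).2]
    have := hh0 (σ (k m))
    have := hh0 (σ (ν m))
    rcases hb1 m with h3 | h3 <;> linarith
  have hb0 : 0 ≤ α (k (m + 1)) - α (k m) := (hh0 _).le.trans (hk1 m)
  have hsq : (α (k (m + 1)) - α (k m)) ^ 2 ≤ 3 * (α (ν m + 1) - α (ν m)) ^ 2 +
      3 * h (σ (k m)) ^ 2 + 3 * h (σ (ν m)) ^ 2 := by
    refine (pow_le_pow_left₀ hb0 hb 2).trans ?_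
    nlinarith [sq_nonneg ((α (ν m + 1) - α (ν m)) - h (σ (k m))),
      sq_nonneg ((α (ν m + 1) - α (ν m)) - h (σ (ν m))), sq_nonneg (h (σ (k m)) - h (σ (ν m)))]
  have hdiv : ∀ x v c : ℝ, 0 ≤ x → 0 < c → 0 < v → v ≤ c * (1 + α (k m) ^ 2) →
      x / (1 + α (k m) ^ 2) ≤ c * (x / v) := by
    intro x v c hx hc hv hle
    rw [← mul_div_assoc, div_le_div_iff₀ hP hv]
    nlinarith
  calc _ ≤ (3 * (α (ν m + 1) - α (ν m)) ^ 2 + 3 * h (σ (k m)) ^ 2 + 3 * h (σ (ν m)) ^ 2) /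
        (1 + α (k m) ^ 2) := by gcongr
    _ = 3 * ((α (ν m + 1) - α (ν m)) ^ 2 / (1 + α (k m) ^ 2)) +
        3 * (h (σ (k m)) ^ 2 / (1 + α (k m) ^ 2)) + 3 * (h (σ (ν m)) ^ 2 / (1 + α (k m) ^ 2)) := by
      ring
    _ ≤ _ := by
      have t1 := hdiv ((α (ν m + 1) - α (ν m)) ^ 2) _ 4 (sq_nonneg _) (by norm_num) hQ hm
      have t2 := hdiv (h (σ (k m)) ^ 2) (w (σ (k m))) 1 (sq_nonneg _) one_pos (hw _)
        (by rw [one_mul]; exact hσw _)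
      have t3 := hdiv (h (σ (ν m)) ^ 2) (w (σ (ν m))) 4 (sq_nonneg _) (by norm_num) (hw _)
        ((hσw _).trans hm)
      linarith

/-- With tails t_n, s_n / √t_n ≤ 2(√t_n - √t_{n+1}), which telescopes. Adding a geometric series
keeps the tails positive. -/
theorem exists_tendsto_atTop_summable_mul_nat {s : ℕ → ℝ} (hs0 : ∀ n, 0 ≤ s n)
    (hs : Summable s) : ∃ M : ℕ → ℝ, (∀ n, 1 ≤ M n) ∧ Tendsto M atTop atTop ∧
      Summable fun n => M n * s n := by
  set u : ℕ → ℝ := fun n => s n + (1 / 2) ^ n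
  have hu : Summable u := hs.add summable_geometric_two
  have hu0 : ∀ n, 0 < u n := fun n => add_pos_of_nonneg_of_pos (hs0 n) (by positivity)
  set t : ℕ → ℝ := fun n => ∑' i, u (i + n)
  have ht : ∀ n, t n = u n + t (n + 1) := by
    intro n
    have := ((summable_nat_add_iff n).mpr hu).tsum_eq_zero_add
    simp only [zero_add] at this
    simp only [t]
    rw [this]
    congr 2
    ext i
    congr 1
    omega
  have ht0 : ∀ n, 0 ≤ t n := fun n => tsum_nonneg fun i => (hu0 _).le
  have htp : ∀ n, 0 < t n := fun n => by
    rw [ht]; exact add_pos_of_pos_of_nonneg (hu0 n) (ht0 _)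
  have htt : Tendsto t atTop (𝓝 0) := tendsto_sum_nat_add u
  have hsq : Tendsto (fun n => (√(t n))⁻¹) atTop atTop := by
    refine tendsto_inv_nhdsGT_zero.comp (tendsto_nhdsWithin_iff.mpr ⟨?_, ?_⟩)
    · simpa using htt.sqrt
    · exact Eventually.of_forall fun n => Real.sqrt_pos.mpr (htp n)
  refine ⟨fun n => 1 + (√(t n))⁻¹, fun n => ?_, tendsto_atTop_add_const_left _ _ hsq, ?_⟩
  · have : 0 ≤ (√(t n))⁻¹ := by positivity
    linarith
  · simp only [add_mul, one_mul]
    refine hs.add ?_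
    have hle : ∀ n, (√(t n))⁻¹ * s n ≤ 2 * (√(t n) - √(t (n + 1))) := by
      intro n
      have h1 := Real.sqrt_pos.mpr (htp n)
      have h2 := Real.sqrt_nonneg (t (n + 1))
      have h3 := Real.sq_sqrt (ht0 n)
      have h4 := Real.sq_sqrt (ht0 (n + 1))
      have h5 : s n ≤ t n - t (n + 1) := by
        rw [ht n]
        have : (0 : ℝ) ≤ (1 / 2) ^ n := by positivity
        simp only [u]
        linarith
      have h6 : √(t (n + 1)) ≤ √(t n) := Real.sqrt_le_sqrt (by linarith [hs0 n])
      rw [inv_mul_le_iff₀ h1]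
      nlinarith
    refine summable_of_sum_range_le (c := 2 * √(t 0))
      (fun n => mul_nonneg (by positivity) (hs0 n)) fun n => ?_
    refine (Finset.sum_le_sum fun i _ => hle i).trans ?_
    rw [← Finset.mul_sum, Finset.sum_range_sub']
    have := Real.sqrt_nonneg (t n)
    linarith

theorem exists_tendsto_atTop_summable_mul {s : ℤ → ℝ} (hs0 : ∀ n, 0 ≤ s n)
    (hs : Summable s) : ∃ M : ℤ → ℝ, (∀ n, 1 ≤ M n) ∧ Tendsto M cofinite atTop ∧
      Summable fun n => M n * s n := by
  set e := Equiv.intEquivNat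
  obtain ⟨M, h1, h2, h3⟩ := exists_tendsto_atTop_summable_mul_nat (s := s ∘ e.symm)
    (fun n => hs0 _) (e.symm.summable_iff.mpr hs)
  refine ⟨M ∘ e, fun n => h1 _, ?_, ?_⟩
  · rw [← Nat.cofinite_eq_atTop] at h2
    exact h2.comp e.injective.tendsto_cofinite
  · refine (e.summable_iff.mpr h3).congr fun n => ?_
    simp


/-! ### Short partitions: indices, weights and two-sided coarsening -/

variable {a a' b : ℤ → ℝ}

theorem tendsto_atTop_of_len (h : Tendsto (len a) atTop atTop) : Tendsto a atTop atTop := by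
  obtain ⟨n₀, hn₀⟩ := eventually_atTop.mp (h.eventually_ge_atTop 1)
  have hlin : ∀ n, n₀ ≤ n → a n₀ + (n - n₀ : ℤ) ≤ a n := by
    intro n hn
    induction n, hn using Int.leInduction with
    | base => simp
    | succ n hn ih =>
      have := hn₀ n hn
      unfold len at this
      push_cast at ih ⊢
      linarith
  refine tendsto_atTop_mono' _ ((eventually_ge_atTop n₀).mono hlin) ?_
  refine tendsto_atTop_add_const_left _ _ ?_
  exact tendsto_intCast_atTop_atTop.comp (tendsto_atTop_add_const_right _ (-n₀) tendsto_id)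

theorem tendsto_atBot_of_len (h : Tendsto (len a) atBot atTop) : Tendsto a atBot atBot := by
  have h1 : Tendsto (len fun n => -a (-n)) atTop atTop := by
    have h2 : Tendsto (fun n : ℤ => -(n + 1)) atTop atBot :=
      tendsto_neg_atTop_atBot.comp (tendsto_atTop_add_const_right _ 1 tendsto_id)
    refine (h.comp h2).congr fun n => ?_
    simp only [Function.comp_apply, len]
    rw [show -(n + 1) + 1 = -n by ring]
    ring
  have h3 := tendsto_neg_atTop_atBot.comp ((tendsto_atTop_of_len h1).comp tendsto_neg_atBot_atTop)
  refine h3.congr fun n => ?_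
  simp

theorem IsShortPartition.tendsto_atTop (h : IsShortPartition a) : Tendsto a atTop atTop :=
  tendsto_atTop_of_len (h.tendsto_len.mono_left le_sup_right)

theorem IsShortPartition.tendsto_atBot (h : IsShortPartition a) : Tendsto a atBot atBot :=
  tendsto_atBot_of_len (h.tendsto_len.mono_left le_sup_left)

/-- Every real number lies in an interval of a short partition. -/
theorem IsShortPartition.exists_index (h : IsShortPartition a) :
    ∃ π : ℝ → ℤ, ∀ x, a (π x) < x ∧ x ≤ a (π x + 1) := by
  have : ∀ x, ∃ n, a n < x ∧ x ≤ a (n + 1) := by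
    intro x
    obtain ⟨N, hN⟩ := (h.tendsto_atTop.eventually_ge_atTop x).exists
    obtain ⟨n, hn, hmax⟩ := Int.exists_greatest_of_bdd (P := fun n => a n < x)
      ⟨N, fun z hz => by
        by_contra! hc
        linarith [h.strictMono.monotone hc.le]⟩ (h.tendsto_atBot.eventually_lt_atBot x).exists
    refine ⟨n, hn, ?_⟩
    by_contra! hc
    have := hmax _ hc
    omega
  choose π hπ using this
  exact ⟨π, hπ⟩

theorem len_pos (ha : StrictMono a) (n : ℤ) : 0 < len a n :=
  sub_pos.mpr (ha (lt_add_one n))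

theorem index_eq_iff (ha : StrictMono a) {π : ℝ → ℤ} (hπ : ∀ x, a (π x) < x ∧ x ≤ a (π x + 1))
    {x : ℝ} {n : ℤ} : π x = n ↔ x ∈ interval a n := by
  constructor
  · rintro rfl
    exact hπ x
  · rintro ⟨h1, h2⟩
    have h3 := ha.lt_iff_lt.mp ((hπ x).1.trans_le h2)
    have h4 := ha.lt_iff_lt.mp (h1.trans_le (hπ x).2)
    omega

theorem index_mono (ha : StrictMono a) {π : ℝ → ℤ} (hπ : ∀ x, a (π x) < x ∧ x ≤ a (π x + 1)) :
    Monotone π := by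
  intro x y hxy
  have := ha.lt_iff_lt.mp (((hπ x).1.trans_le hxy).trans_le (hπ y).2)
  omega

theorem tendsto_index_atTop (ha : StrictMono a) {π : ℝ → ℤ}
    (hπ : ∀ x, a (π x) < x ∧ x ≤ a (π x + 1)) : Tendsto π atTop atTop := by
  refine tendsto_atTop.mpr fun n => ?_
  filter_upwards [eventually_gt_atTop (a n)] with x hx
  have := ha.lt_iff_lt.mp (hx.trans_le (hπ x).2)
  omega

theorem tendsto_index_atBot (ha : StrictMono a) {π : ℝ → ℤ}
    (hπ : ∀ x, a (π x) < x ∧ x ≤ a (π x + 1)) : Tendsto π atBot atBot := by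
  refine tendsto_atBot.mpr fun n => ?_
  filter_upwards [eventually_le_atBot (a n)] with x hx
  exact (ha.lt_iff_lt.mp ((hπ x).1.trans_le hx)).le

theorem weight_pos (a : ℤ → ℝ) (n : ℤ) : 0 < weight a n := by
  unfold weight
  positivity

theorem weight_le (ha : StrictMono a) {n : ℤ} {x : ℝ} (hx : x ∈ Icc (a n) (a (n + 1))) :
    weight a n ≤ 1 + x ^ 2 := by
  have h : Metric.infDist 0 (interval a n) ≤ |x| := by
    rw [← Metric.infDist_closure, interval, closure_Ioc (ha (lt_add_one n)).ne]
    simpa using Metric.infDist_le_dist_of_mem (x := 0) hx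
  unfold weight
  rw [← sq_abs x]
  gcongr
  exact Metric.infDist_nonneg

theorem le_weight_of_forall (ha : StrictMono a) {n : ℤ} {d : ℝ} (hd : 0 ≤ d)
    (h : ∀ x ∈ interval a n, d ≤ |x|) : 1 + d ^ 2 ≤ weight a n := by
  unfold weight
  gcongr
  refine (Metric.le_infDist (nonempty_Ioc.mpr (ha (lt_add_one n)))).mpr fun y hy => ?_
  simpa using h y hy

theorem le_weight_of_nonneg (ha : StrictMono a) (h0 : a 0 = 0) {n : ℤ} (hn : 0 ≤ n) :
    1 + a n ^ 2 ≤ weight a n := by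
  have h1 : 0 ≤ a n := h0 ▸ ha.monotone hn
  exact le_weight_of_forall ha h1 fun x hx => hx.1.le.trans (le_abs_self x)

theorem le_weight_of_neg (ha : StrictMono a) (h0 : a 0 = 0) {n : ℤ} (hn : n < 0) :
    1 + a (n + 1) ^ 2 ≤ weight a n := by
  have h1 : a (n + 1) ≤ 0 := h0 ▸ ha.monotone (by omega)
  rw [← neg_sq]
  exact le_weight_of_forall ha (by linarith) fun x hx =>
    (neg_le_neg hx.2).trans (neg_le_abs x)

/-- The half-line construction is run on the positive endpoints and on the reflected negative ones.
Both runs start at the endpoint 0, so they glue. -/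
theorem exists_coarsening_seq (ha : IsShortPartition a) (ha' : IsShortPartition a')
    {π : ℝ → ℤ} (hπ : ∀ x, a' (π x) < x ∧ x ≤ a' (π x + 1)) {h : ℤ → ℝ}
    (hlen : ∀ j, len a' j ≤ h j) (hs : Summable fun j => h j ^ 2 / weight a' j) :
    ∃ k : ℤ → ℤ, StrictMono k ∧ k 0 = 0 ∧ (Summable fun m => len (a ∘ k) m ^ 2 / weight (a ∘ k) m) ∧
      (∀ m, h (π (a (k m))) ≤ len (a ∘ k) m) ∧ ∀ m, h (π (a (k (m + 1)))) ≤ len (a ∘ k) m := by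
  have hh0 : ∀ j, 0 < h j := fun j => (len_pos ha'.strictMono j).trans_le (hlen j)
  have hmono := index_mono ha'.strictMono hπ
  have hclose : ∀ x y, π x = π y → y - x < h (π x) := by
    intro x y e
    refine lt_of_lt_of_le ?_ (hlen _)
    have h1 := (hπ x).1
    have h2 := (hπ y).2
    rw [← e] at h2
    unfold len
    linarith
  have hwt : ∀ x, weight a' (π x) ≤ 1 + x ^ 2 := fun x =>
    weight_le ha'.strictMono ⟨(hπ x).1.le, (hπ x).2⟩
  obtain ⟨kp, kp1, kp2, kp3, kp4, kp5⟩ := exists_coarsening_nat (α := fun n : ℕ => a n)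
    (σ := fun n : ℕ => π (a n)) (h := h) (w := weight a')
    (fun m n hmn => ha.strictMono (by exact_mod_cast hmn)) (by simpa using ha.zero)
    (ha.tendsto_atTop.comp tendsto_natCast_atTop_atTop)
    (by
      refine Summable.of_nonneg_of_le (fun n => by positivity) (fun n => ?_)
        (ha.short.comp_injective Nat.cast_injective)
      have := weight_le ha.strictMono (left_mem_Icc.mpr (ha.strictMono (lt_add_one (n : ℤ))).le)
      have := weight_pos a n
      simp only [Function.comp_apply, len, Nat.cast_add, Nat.cast_one]
      gcongr)
    (fun l m n h1 h2 e => le_antisymm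
      ((hmono (ha.strictMono.monotone (by exact_mod_cast h2))).trans e.symm.le)
      (hmono (ha.strictMono.monotone (by exact_mod_cast h1))))
    (by
      rw [Int.cofinite_eq]
      exact ((tendsto_index_atTop ha'.strictMono hπ).comp (ha.tendsto_atTop.comp
        tendsto_natCast_atTop_atTop)).mono_right le_sup_right)
    hh0 (weight_pos a') (fun m n _ e => hclose _ _ e) (fun n => hwt _) hs
  obtain ⟨kn, kn1, kn2, kn3, kn4, kn5⟩ := exists_coarsening_nat (α := fun n : ℕ => -a (-n))
    (σ := fun n : ℕ => π (a (-n))) (h := h) (w := weight a')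
    (fun m n hmn => neg_lt_neg (ha.strictMono (by simpa using hmn))) (by simpa using ha.zero)
    (tendsto_neg_atBot_atTop.comp (ha.tendsto_atBot.comp
      (tendsto_neg_atTop_atBot.comp tendsto_natCast_atTop_atTop)))
    (by
      refine Summable.of_nonneg_of_le (fun n => by positivity) (fun n => ?_)
        (ha.short.comp_injective (i := fun n : ℕ => -((n : ℤ) + 1)) fun m n e => by
          simp only at e; omega)
      have hle := weight_le ha.strictMono (right_mem_Icc.mpr
        (ha.strictMono (lt_add_one (-((n : ℤ) + 1)))).le)
      have := weight_pos a (-((n : ℤ) + 1))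
      have e : -((n : ℤ) + 1) + 1 = -n := by ring
      rw [e] at hle
      simp only [Function.comp_apply, len, Nat.cast_add, Nat.cast_one, e, neg_sq]
      rw [show -a (-((n : ℤ) + 1)) - -a (-n) = a (-n) - a (-((n : ℤ) + 1)) by ring]
      gcongr)
    (fun l m n h1 h2 e => le_antisymm
      (hmono (ha.strictMono.monotone (by simpa using h1)))
      (e.le.trans (hmono (ha.strictMono.monotone (by simpa using h2)))))
    (by
      rw [Int.cofinite_eq]
      exact ((tendsto_index_atBot ha'.strictMono hπ).comp (ha.tendsto_atBot.comp
        (tendsto_neg_atTop_atBot.comp tendsto_natCast_atTop_atTop))).mono_right le_sup_left)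
    hh0 (weight_pos a')
    (fun m n _ e => by
      have := hclose _ _ e.symm
      rw [e]
      linarith)
    (fun n => by rw [neg_sq]; exact hwt _) hs
  set k : ℤ → ℤ := fun m => if 0 ≤ m then (kp m.toNat : ℤ) else -(kn (-m).toNat : ℤ)
  have hkp : ∀ m : ℕ, k m = kp m := fun m => by simp [k]
  have hkn : ∀ m : ℕ, k (-m) = -kn m := by
    intro m
    rcases Nat.eq_zero_or_pos m with rfl | hm
    · simp [k, kp2, kn2]
    · have : ¬ (0 : ℤ) ≤ -m := by omega
      simp [k, hm.ne']
  have hkn' : ∀ m : ℕ, k (-((m : ℤ) + 1)) = -kn (m + 1) := fun m => by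
    have := hkn (m + 1)
    push_cast at this
    exact this
  have hkn'' : ∀ m : ℕ, k (-((m : ℤ) + 1) + 1) = -kn m := fun m => by
    rw [← hkn m]
    congr 1
    ring
  have hkp' : ∀ m : ℕ, k ((m : ℤ) + 1) = kp (m + 1) := fun m => by
    have := hkp (m + 1)
    push_cast at this
    exact this
  have hcases : ∀ P : ℤ → Prop, (∀ m : ℕ, P m) → (∀ m : ℕ, P (-((m : ℤ) + 1))) → ∀ m, P m := by
    intro P h1 h2 m
    rcases le_or_gt 0 m with hm | hm
    · lift m to ℕ using hm
      exact h1 m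
    · have := h2 (-m - 1).toNat
      rwa [Int.toNat_of_nonneg (by omega), show -(-m - 1 + 1) = m by ring] at this
  have hk : StrictMono k := by
    refine strictMono_int_of_lt_succ (hcases _ (fun m => ?_) fun m => ?_)
    · rw [hkp, hkp']
      exact_mod_cast kp1 m.lt_succ_self
    · rw [hkn', hkn'']
      have := kn1 m.lt_succ_self
      simp only [Nat.succ_eq_add_one] at this
      omega
  have hk0 : k 0 = 0 := by simpa [kp2] using hkp 0
  have hbm : StrictMono (a ∘ k) := ha.strictMono.comp hk
  have hb0 : (a ∘ k) 0 = 0 := by simp [hk0, ha.zero]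
  refine ⟨k, hk, hk0, ?_, hcases _ (fun m => ?_) fun m => ?_, hcases _ (fun m => ?_) fun m => ?_⟩
  · refine Summable.of_nat_of_neg_add_one ?_ ?_
    · refine Summable.of_nonneg_of_le (fun n => by have := weight_pos (a ∘ k) n; positivity)
        (fun n => ?_) kp5
      have := le_weight_of_nonneg hbm hb0 (n := n) (by positivity)
      simp only [len, Function.comp_apply, hkp, hkp'] at this ⊢
      gcongr
    · refine Summable.of_nonneg_of_le
        (fun n => by have := weight_pos (a ∘ k) (-((n : ℤ) + 1)); positivity) (fun n => ?_) kn5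
      have := le_weight_of_neg hbm hb0 (n := -((n : ℤ) + 1)) (by omega)
      simp only [len, Function.comp_apply, hkn', hkn'', neg_sq] at this ⊢
      rw [show -a (-(kn (n + 1) : ℤ)) - -a (-(kn n : ℤ)) = a (-kn n) - a (-kn (n + 1)) by ring]
      gcongr
  · simpa [len, hkp, hkp'] using kp3 m
  · have := kn4 m
    simp only [len, Function.comp_apply, hkn', hkn'']
    linarith
  · simpa [len, hkp, hkp'] using kp4 m
  · have := kn3 m
    simp only [len, Function.comp_apply, hkn', hkn'']
    linarith


/-! ### Counting points and transferring densities between partitions -/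

theorem IsDiscreteSeq.finite_inter_Ioc {L : Set ℝ} (h : IsDiscreteSeq L) (l u : ℝ) :
    (L ∩ Ioc l u).Finite := by
  by_contra hinf
  obtain ⟨x, -, hx⟩ := Set.Infinite.exists_accPt_of_subset_isCompact hinf
    (isCompact_Icc (a := l) (b := u)) (inter_subset_right.trans Ioc_subset_Icc_self)
  exact h x (hx.mono (principal_mono.mpr inter_subset_left))

theorem IsDiscreteSeq.mono {L F : Set ℝ} (h : IsDiscreteSeq L) (hF : F ⊆ L) : IsDiscreteSeq F :=
  fun x hx => h x (hx.mono (principal_mono.mpr hF))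

theorem ncard_eq_sum_count (ha : Monotone a) {L : Set ℝ} (hL : IsDiscreteSeq L) {p q : ℤ}
    (hpq : p ≤ q) : (L ∩ Ioc (a p) (a q)).ncard = ∑ n ∈ Finset.Ico p q, count L a n := by
  induction q, hpq using Int.leInduction with
  | base => simp
  | succ q hq ih =>
    rw [← Finset.insert_Ico_right_eq_Ico_add_one hq, Finset.sum_insert (by simp), ← ih,
      ← Ioc_union_Ioc_eq_Ioc (ha hq) (ha (by omega : q ≤ q + 1)), inter_union_distrib_left,
      ncard_union_eq ?_ (hL.finite_inter_Ioc _ _) (hL.finite_inter_Ioc _ _), add_comm]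
    · rfl
    · rw [Set.disjoint_left]
      rintro x ⟨-, hx⟩ ⟨-, hx'⟩
      exact absurd hx.2 (not_le.mpr hx'.1)

theorem sum_len (a : ℤ → ℝ) {p q : ℤ} (hpq : p ≤ q) :
    ∑ n ∈ Finset.Ico p q, len a n = a q - a p := by
  induction q, hpq using Int.leInduction with
  | base => simp
  | succ q hq ih =>
    rw [← Finset.insert_Ico_right_eq_Ico_add_one hq, Finset.sum_insert (by simp), ih]
    unfold len
    ring

theorem eventually_forall_between {P : ℤ → Prop} (hP : ∀ᶠ j in atBot ⊔ atTop, P j) {lo hi : ℤ → ℤ}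
    (hlo : Tendsto lo atTop atTop) (hhi : Tendsto hi atBot atBot) :
    ∀ᶠ m in atBot ⊔ atTop, ∀ j, lo m ≤ j → j ≤ hi m → P j := by
  rw [eventually_sup] at hP ⊢
  obtain ⟨N₁, h₁⟩ := eventually_atBot.mp hP.1
  obtain ⟨N₂, h₂⟩ := eventually_atTop.mp hP.2
  constructor
  · filter_upwards [hhi.eventually_le_atBot N₁] with m hm j _ hj
    exact h₁ j (hj.trans hm)
  · filter_upwards [hlo.eventually_ge_atTop N₂] with m hm j hj _
    exact h₂ j (hm.trans hj)

/-- The density condition passes from a partition to any other one in which the intervals of the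
first that contain an endpoint are negligible. -/
theorem DensityCondition.transfer {c : ℝ} {G : Set ℝ} (hG : DensityCondition c G a')
    (hGd : IsDiscreteSeq G) (ha' : StrictMono a') {π : ℝ → ℤ}
    (hπ : ∀ x, a' (π x) < x ∧ x ≤ a' (π x + 1)) (hb : StrictMono b)
    (hbt : Tendsto b atTop atTop) (hbb : Tendsto b atBot atBot)
    (h1 : ∀ ε > 0, ∀ᶠ m in atBot ⊔ atTop, len a' (π (b m)) ≤ ε * len b m)
    (h2 : ∀ ε > 0, ∀ᶠ m in atBot ⊔ atTop, len a' (π (b (m + 1))) ≤ ε * len b m) :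
    DensityCondition c G b := by
  rw [DensityCondition, isLittleO_iff] at hG ⊢
  intro ε hε
  -- Each of the two end cells costs `|c| + 1` times its length in the count and `|c|` times in the
  -- length; the cells in between cost a single δ.
  set δ := min 1 (ε / (1 + 2 * (2 * |c| + 1))) with hδ
  have hcp : 0 < 1 + 2 * (2 * |c| + 1) := by positivity
  have hδ0 : 0 < δ := lt_min one_pos (by positivity)
  have hδ1 : δ ≤ 1 := min_le_left _ _
  have hδ2 : δ * (1 + 2 * (2 * |c| + 1)) ≤ ε := (le_div_iff₀ hcp).mp (min_le_right _ _)
  have hlo : Tendsto (fun m => π (b m)) atTop atTop := (tendsto_index_atTop ha' hπ).comp hbt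
  have hhi : Tendsto (fun m => π (b (m + 1))) atBot atBot :=
    (tendsto_index_atBot ha' hπ).comp (hbb.comp (tendsto_atBot_add_const_right _ 1 tendsto_id))
  filter_upwards [eventually_forall_between (hG hδ0) hlo hhi, h1 δ hδ0, h2 δ hδ0] with m hm hl hr
  set j₀ := π (b m) with hj₀
  set j₁ := π (b (m + 1)) with hj₁
  have hlt : b m < b (m + 1) := hb (lt_add_one m)
  have hj : j₀ ≤ j₁ := index_mono ha' hπ hlt.le
  have hlp := len_pos ha'
  have hm' : ∀ j, j₀ ≤ j → j ≤ j₁ → |(count G a' j : ℝ) - c * len a' j| ≤ δ * len a' j := by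
    intro j hj hj'
    have := hm j hj hj'
    rwa [Real.norm_eq_abs, Real.norm_of_nonneg (hlp j).le] at this
  rw [Real.norm_eq_abs, Real.norm_of_nonneg (len_pos hb m).le]
  -- Totals over the cells strictly between those containing the two endpoints; both are zero when
  -- the endpoints share a cell.
  set s : ℝ := ∑ n ∈ Finset.Ico (j₀ + 1) j₁, len a' n with hs
  set t : ℝ := ∑ n ∈ Finset.Ico (j₀ + 1) j₁, (count G a' n : ℝ) with ht
  have hst : |t - c * s| ≤ δ * s := by
    rw [ht, hs, Finset.mul_sum, Finset.mul_sum, ← Finset.sum_sub_distrib]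
    refine (Finset.abs_sum_le_sum_abs _ _).trans (Finset.sum_le_sum fun n hn => ?_)
    rw [Finset.mem_Ico] at hn
    exact hm' n (by omega) (by omega)
  have hend : ∀ j, j₀ ≤ j → j ≤ j₁ → (count G a' j : ℝ) ≤ (|c| + 1) * len a' j := by
    intro j hj hj'
    have h1 := (abs_le.mp (hm' j hj hj')).2
    have h2 := mul_le_mul_of_nonneg_right (le_abs_self c) (hlp j).le
    have h3 := mul_le_mul_of_nonneg_right hδ1 (hlp j).le
    linarith
  have e0 := hend j₀ le_rfl hj
  have e1 := hend j₁ hj le_rfl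
  have hB0 := hπ (b m)
  have hB1 := hπ (b (m + 1))
  rw [← hj₀] at hB0
  rw [← hj₁] at hB1
  have hlenb : len b m = b (m + 1) - b m := rfl
  have hl0 : len a' j₀ = a' (j₀ + 1) - a' j₀ := rfl
  have hl1 : len a' j₁ = a' (j₁ + 1) - a' j₁ := rfl
  have hslen : s ≤ len b m ∧ len b m ≤ s + len a' j₀ + len a' j₁ := by
    rcases hj.eq_or_lt with e | e
    · have : s = 0 := by rw [hs, Finset.Ico_eq_empty (by omega), Finset.sum_empty]
      have := hlp j₁
      rw [e] at hB0 hl0 ⊢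
      constructor <;> linarith
    · have : s = a' j₁ - a' (j₀ + 1) := sum_len a' (by omega)
      constructor <;> linarith
  have htcount : t ≤ count G b m ∧ (count G b m : ℝ) ≤ t + count G a' j₀ + count G a' j₁ := by
    constructor
    · rcases hj.eq_or_lt with e | e
      · rw [ht, Finset.Ico_eq_empty (by omega), Finset.sum_empty]
        positivity
      · have h := ncard_eq_sum_count ha'.monotone hGd (show j₀ + 1 ≤ j₁ by omega)
        rw [ht, ← Nat.cast_sum, ← h, Nat.cast_le]
        exact ncard_le_ncard (inter_subset_inter_right _ (Ioc_subset_Ioc hB0.2 hB1.1.le))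
          (hGd.finite_inter_Ioc _ _)
    · have h := ncard_eq_sum_count ha'.monotone hGd (show j₀ ≤ j₁ + 1 by omega)
      have h3 : count G b m ≤ ∑ n ∈ Finset.Ico j₀ (j₁ + 1), count G a' n := by
        rw [← h]
        exact ncard_le_ncard (inter_subset_inter_right _ (Ioc_subset_Ioc hB0.1.le hB1.2))
          (hGd.finite_inter_Ioc _ _)
      have h4 : ∑ n ∈ Finset.Ico j₀ (j₁ + 1), count G a' n ≤
          ∑ n ∈ Finset.Ico (j₀ + 1) j₁, count G a' n + count G a' j₀ + count G a' j₁ := by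
        rw [← Finset.insert_Ico_right_eq_Ico_add_one hj, Finset.sum_insert (by simp)]
        rcases hj.eq_or_lt with e | e
        · rw [Finset.Ico_eq_empty (by omega), Finset.sum_empty, ← e]
          omega
        · rw [← Finset.insert_Ico_add_one_left_eq_Ico e, Finset.sum_insert (by simp)]
          omega
      have := h3.trans h4
      rw [ht]
      exact_mod_cast this
  have hs0 : 0 ≤ s := Finset.sum_nonneg fun n _ => (hlp n).le
  have hcs : |c * s - c * len b m| ≤ |c| * (len a' j₀ + len a' j₁) := by
    rw [← mul_sub, abs_mul]
    refine mul_le_mul_of_nonneg_left ?_ (abs_nonneg c)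
    rw [abs_le]
    constructor <;> linarith [hlp j₀, hlp j₁]
  have hct : |(count G b m : ℝ) - t| ≤ (|c| + 1) * (len a' j₀ + len a' j₁) := by
    rw [abs_le]
    have := hlp j₀
    have := hlp j₁
    have : 0 ≤ (|c| + 1) * (len a' j₀ + len a' j₁) := by positivity
    constructor <;> linarith [htcount.1, htcount.2]
  calc |(count G b m : ℝ) - c * len b m|
      = |((count G b m : ℝ) - t) + (t - c * s) + (c * s - c * len b m)| := by congr 1; ring
    _ ≤ (|c| + 1) * (len a' j₀ + len a' j₁) + δ * s + |c| * (len a' j₀ + len a' j₁) :=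
        (abs_add_three _ _ _).trans (add_le_add (add_le_add hct hst) hcs)
    _ = (2 * |c| + 1) * (len a' j₀ + len a' j₁) + δ * s := by ring
    _ ≤ (2 * |c| + 1) * (δ * len b m + δ * len b m) + δ * len b m := by
        have := hslen.1
        gcongr
    _ = δ * (1 + 2 * (2 * |c| + 1)) * len b m := by ring
    _ ≤ ε * len b m := by
        have := (len_pos hb m).le
        gcongr

theorem tendsto_sup_of_strictMono {k : ℤ → ℤ} (hk : StrictMono k) :
    Tendsto k (atBot ⊔ atTop) (atBot ⊔ atTop) := by
  rw [← Int.cofinite_eq]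
  exact hk.injective.tendsto_cofinite

theorem monotone_sub_self {k : ℤ → ℤ} (hk : StrictMono k) : Monotone fun n => k n - n :=
  monotone_int_of_le_succ fun n => by
    have := hk (lt_add_one n)
    omega

theorem tendsto_atTop_of_strictMono {k : ℤ → ℤ} (hk : StrictMono k) : Tendsto k atTop atTop := by
  refine tendsto_atTop_mono' _ ((eventually_ge_atTop 0).mono fun n hn => ?_)
    (tendsto_atTop_add_const_right _ (k 0) tendsto_id)
  have := monotone_sub_self hk hn
  simp only [id] at this ⊢
  omega

theorem tendsto_atBot_of_strictMono {k : ℤ → ℤ} (hk : StrictMono k) : Tendsto k atBot atBot := by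
  refine tendsto_atBot_mono' _ ((eventually_le_atBot 0).mono fun n hn => ?_)
    (tendsto_atBot_add_const_right _ (k 0) tendsto_id)
  have := monotone_sub_self hk hn
  simp only [id] at this ⊢
  omega

theorem eventually_forall_block {P : ℤ → Prop} (hP : ∀ᶠ j in atBot ⊔ atTop, P j) {k : ℤ → ℤ}
    (hk : StrictMono k) :
    ∀ᶠ m in atBot ⊔ atTop, ∀ j ∈ Finset.Ico (k m) (k (m + 1)), P j := by
  filter_upwards [eventually_forall_between hP (tendsto_atTop_of_strictMono hk)
    ((tendsto_atBot_of_strictMono hk).comp (tendsto_atBot_add_const_right _ 1 tendsto_id))]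
    with m hm j hj
  rw [Finset.mem_Ico] at hj
  exact hm j hj.1 hj.2.le

theorem len_comp_eq_sum (a : ℤ → ℝ) {k : ℤ → ℤ} (hk : StrictMono k) (m : ℤ) :
    len (a ∘ k) m = ∑ n ∈ Finset.Ico (k m) (k (m + 1)), len a n :=
  (sum_len a (hk (lt_add_one m)).le).symm

theorem count_comp_eq_sum (ha : Monotone a) {k : ℤ → ℤ} (hk : StrictMono k) {L : Set ℝ}
    (hL : IsDiscreteSeq L) (m : ℤ) :
    count L (a ∘ k) m = ∑ n ∈ Finset.Ico (k m) (k (m + 1)), count L a n :=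
  ncard_eq_sum_count ha hL (hk (lt_add_one m)).le

theorem DensityCondition.coarsen {d : ℝ} {L : Set ℝ} (h : DensityCondition d L a)
    (hL : IsDiscreteSeq L) (ha : StrictMono a) {k : ℤ → ℤ} (hk : StrictMono k) :
    DensityCondition d L (a ∘ k) := by
  rw [DensityCondition, isLittleO_iff] at h ⊢
  intro ε hε
  filter_upwards [eventually_forall_block (h hε) hk] with m hm
  rw [Real.norm_eq_abs, Real.norm_of_nonneg (len_pos (ha.comp hk) m).le,
    len_comp_eq_sum a hk, count_comp_eq_sum ha.monotone hk hL, Nat.cast_sum, Finset.mul_sum,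
    Finset.mul_sum, ← Finset.sum_sub_distrib]
  refine (Finset.abs_sum_le_sum_abs _ _).trans (Finset.sum_le_sum fun n hn => ?_)
  have := hm n hn
  rwa [Real.norm_eq_abs, Real.norm_of_nonneg (len_pos ha n).le] at this

theorem tendsto_len_comp (ha : IsShortPartition a) {k : ℤ → ℤ} (hk : StrictMono k) :
    Tendsto (len (a ∘ k)) (atBot ⊔ atTop) atTop := by
  refine tendsto_atTop_mono (fun m => ?_) (ha.tendsto_len.comp (tendsto_sup_of_strictMono hk))
  rw [len_comp_eq_sum a hk]
  exact Finset.single_le_sum (f := len a) (fun n _ => (len_pos ha.strictMono n).le)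
    (Finset.left_mem_Ico.mpr (hk (lt_add_one m)))

/-- A short partition can be coarsened to a short partition on which density conditions with
respect to a second given short partition hold. -/
theorem exists_coarsening (ha : IsShortPartition a) (ha' : IsShortPartition a') :
    ∃ k : ℤ → ℤ, StrictMono k ∧ IsShortPartition (a ∘ k) ∧
      ∀ (c : ℝ) (G : Set ℝ), IsDiscreteSeq G → DensityCondition c G a' →
        DensityCondition c G (a ∘ k) := by
  obtain ⟨π, hπ⟩ := ha'.exists_index
  -- Requiring new intervals to dominate √M times the cell length, with M → ∞, turns "at least as
  -- long" into "negligible" and keeps the squares summable.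
  obtain ⟨M, hM1, hMt, hMs⟩ := exists_tendsto_atTop_summable_mul
    (fun n => div_nonneg (sq_nonneg (len a' n)) (weight_pos a' n).le) ha'.short
  rw [Int.cofinite_eq] at hMt
  have hlp := len_pos ha'.strictMono
  obtain ⟨k, hk, hk0, hks, h1, h2⟩ := exists_coarsening_seq ha ha' hπ
    (h := fun j => √(M j) * len a' j)
    (fun j => le_mul_of_one_le_left (hlp j).le (Real.one_le_sqrt.mpr (hM1 j)))
    (hMs.congr fun j => by
      rw [mul_pow, Real.sq_sqrt (zero_le_one.trans (hM1 j)), mul_div_assoc])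
  have hb : IsShortPartition (a ∘ k) :=
    ⟨ha.strictMono.comp hk, by simp [hk0, ha.zero], tendsto_len_comp ha hk, hks⟩
  refine ⟨k, hk, hb, fun c G hGd hG => ?_⟩
  have hπb : Tendsto (fun m => π ((a ∘ k) m)) (atBot ⊔ atTop) (atBot ⊔ atTop) := by
    refine tendsto_sup.mpr ⟨?_, ?_⟩
    · exact ((tendsto_index_atBot ha'.strictMono hπ).comp hb.tendsto_atBot).mono_right le_sup_left
    · exact ((tendsto_index_atTop ha'.strictMono hπ).comp hb.tendsto_atTop).mono_right le_sup_right
  -- The quantifier over `x` is needed because the cell at an endpoint is compared with the new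
  -- intervals on both sides of it.
  have hsmall : ∀ ε > 0, ∀ᶠ m in atBot ⊔ atTop, ∀ x, √(M (π ((a ∘ k) m))) *
      len a' (π ((a ∘ k) m)) ≤ x → len a' (π ((a ∘ k) m)) ≤ ε * x := by
    intro ε hε
    filter_upwards [(hMt.comp hπb).eventually_ge_atTop ((1 / ε) ^ 2)] with m hm x hx
    have h3 : 1 / ε ≤ √(M (π ((a ∘ k) m))) := Real.le_sqrt_of_sq_le hm
    have h4 := (mul_le_mul_of_nonneg_right h3 (hlp (π ((a ∘ k) m))).le).trans hx
    rwa [one_div, inv_mul_le_iff₀ hε] at h4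
  refine hG.transfer hGd ha'.strictMono hπ hb.strictMono hb.tendsto_atTop hb.tendsto_atBot ?_ ?_
  · intro ε hε
    filter_upwards [hsmall ε hε] with m hm
    exact hm _ (h1 m)
  · intro ε hε
    have hsucc : Tendsto (fun m : ℤ => m + 1) (atBot ⊔ atTop) (atBot ⊔ atTop) :=
      tendsto_sup_of_strictMono fun x y h => by simpa using h
    filter_upwards [hsucc.eventually (hsmall ε hε)] with m hm
    exact hm _ (h2 m)


/-! ### Energy on a coarser partition -/

/-- The points of a discrete sequence in the interval `I_n`, as a finite set. -/
def IsDiscreteSeq.points {L : Set ℝ} (h : IsDiscreteSeq L) (a : ℤ → ℝ) (n : ℤ) : Finset ℝ :=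
  (h.finite_inter_Ioc (a n) (a (n + 1))).toFinset

theorem IsDiscreteSeq.mem_points {L : Set ℝ} (h : IsDiscreteSeq L) {n : ℤ} {x : ℝ} :
    x ∈ h.points a n ↔ x ∈ L ∧ a n < x ∧ x ≤ a (n + 1) := by
  simp [points, Set.mem_Ioc]

theorem IsDiscreteSeq.coe_points {L : Set ℝ} (h : IsDiscreteSeq L) (a : ℤ → ℝ) (n : ℤ) :
    (h.points a n : Set ℝ) = L ∩ interval a n := by
  simp [points, interval]

theorem IsDiscreteSeq.card_points {L : Set ℝ} (h : IsDiscreteSeq L) (a : ℤ → ℝ) (n : ℤ) :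
    (h.points a n).card = count L a n := by
  rw [count, ← h.coe_points, Set.ncard_coe_finset]

theorem IsDiscreteSeq.abs_sub_le_len {L : Set ℝ} (h : IsDiscreteSeq L) {n : ℤ} :
    ∀ x ∈ h.points a n, ∀ y ∈ h.points a n, |x - y| ≤ len a n := by
  intro x hx y hy
  rw [h.mem_points] at hx hy
  rw [abs_le]
  unfold len
  constructor <;> linarith [hx.2.1, hx.2.2, hy.2.1, hy.2.2]

theorem energyCondition_iff {L : Set ℝ} (h : IsDiscreteSeq L) (ha : StrictMono a) :
    EnergyCondition L a ↔ Summable fun n => (logEnergy (len a n) (h.points a n) +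
      count L a n * Real.log (len a n)) / weight a n := by
  refine summable_congr fun n => ?_
  rw [← h.coe_points, ← h.card_points, sq_mul_log_sub_energy _ (len_pos ha n)]

theorem EnergyCondition.summable_logEnergy {L : Set ℝ} (hE : EnergyCondition L a)
    (h : IsDiscreteSeq L) (ha : IsShortPartition a) :
    Summable fun n => logEnergy (len a n) (h.points a n) / weight a n := by
  refine Summable.of_norm_bounded_eventually ((energyCondition_iff h ha.strictMono).mp hE) ?_
  rw [Int.cofinite_eq]
  filter_upwards [ha.tendsto_len.eventually_ge_atTop 1] with n hn
  have hw := weight_pos a n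
  rw [Real.norm_of_nonneg (div_nonneg (logEnergy_nonneg h.abs_sub_le_len) hw.le)]
  have := Real.log_nonneg hn
  gcongr
  exact le_add_of_nonneg_right (by positivity)

theorem block_unique {k : ℤ → ℤ} (hk : StrictMono k) {n m m' : ℤ}
    (h : n ∈ Finset.Ico (k m) (k (m + 1))) (h' : n ∈ Finset.Ico (k m') (k (m' + 1))) : m = m' := by
  rw [Finset.mem_Ico] at h h'
  have h1 := hk.lt_iff_lt.mp (h.1.trans_lt h'.2)
  have h2 := hk.lt_iff_lt.mp (h'.1.trans_lt h.2)
  omega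

theorem summable_block {f : ℤ → ℝ} (hf0 : ∀ n, 0 ≤ f n) (hf : Summable f) {k : ℤ → ℤ}
    (hk : StrictMono k) : Summable fun m => ∑ n ∈ Finset.Ico (k m) (k (m + 1)), f n := by
  refine summable_of_sum_le (fun m => Finset.sum_nonneg fun n _ => hf0 n)
    (c := ∑' n, f n) fun u => ?_
  rw [← Finset.sum_biUnion]
  · exact hf.sum_le_tsum _ fun n _ => hf0 n
  · intro m _ m' _ hmm
    rw [Function.onFun, Finset.disjoint_left]
    exact fun n h h' => hmm (block_unique hk h h')

/-- With D the distance from 0 to the block, shortness eventually gives len² < 1 + D². A point x of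
the block has |x| ≤ D + len, so 1 + x² ≤ 1 + 2D² + 2 len² ≤ 4(1 + D²). -/
theorem eventually_weight_le (ha : IsShortPartition a) {k : ℤ → ℤ}
    (hb : IsShortPartition (a ∘ k)) : ∀ᶠ m in atBot ⊔ atTop,
      ∀ n ∈ Finset.Ico (k m) (k (m + 1)), weight a n ≤ 4 * weight (a ∘ k) m := by
  rw [← Int.cofinite_eq]
  filter_upwards [hb.short.tendsto_cofinite_zero.eventually (gt_mem_nhds one_pos)] with m hm n hn
  rw [div_lt_one (weight_pos _ _)] at hm
  rw [Finset.mem_Ico] at hn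
  set x := a (n + 1)
  have hx : x ∈ interval (a ∘ k) m :=
    ⟨ha.strictMono (by omega), ha.strictMono.monotone (by omega)⟩
  have h1 : weight a n ≤ 1 + x ^ 2 :=
    weight_le ha.strictMono (right_mem_Icc.mpr (ha.strictMono (lt_add_one n)).le)
  have h2 : |x| - len (a ∘ k) m ≤ Metric.infDist 0 (interval (a ∘ k) m) := by
    refine (Metric.le_infDist ⟨x, hx⟩).mpr fun y hy => ?_
    rw [dist_zero_left, Real.norm_eq_abs]
    have h3 : |x - y| ≤ len (a ∘ k) m := by
      rw [abs_le]
      unfold len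
      constructor <;> linarith [hx.1, hx.2, hy.1, hy.2]
    linarith [abs_sub_abs_le_abs_sub x y]
  have h3 : 0 ≤ Metric.infDist 0 (interval (a ∘ k) m) := Metric.infDist_nonneg
  have h4 := len_pos hb.strictMono m
  rw [← sq_abs] at h1
  unfold weight at hm h1 ⊢
  generalize Metric.infDist 0 (interval (a ∘ k) m) = D at *
  have h5 : |x| ^ 2 ≤ (D + len (a ∘ k) m) ^ 2 :=
    pow_le_pow_left₀ (abs_nonneg x) (by linarith) 2
  nlinarith [sq_nonneg (D - len (a ∘ k) m)]

/-- If `L` satisfies the density and energy conditions on a short partition, then after removal of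
a subset of density zero every subset satisfies the energy condition on a coarser partition. -/
theorem exists_negligible_energyCondition {d : ℝ} {L : Set ℝ} (hL : IsDiscreteSeq L)
    (ha : IsShortPartition a) (hd : DensityCondition d L a) (hE : EnergyCondition L a)
    {k : ℤ → ℤ} (hk : StrictMono k) (hb : IsShortPartition (a ∘ k)) :
    ∃ D ⊆ L, DensityCondition 0 D (a ∘ k) ∧ ∀ F ⊆ L \ D, EnergyCondition F (a ∘ k) := by
  classical
  obtain ⟨π, hπ⟩ := ha.exists_index
  have hlp := len_pos ha.strictMono
  have hblp := len_pos hb.strictMono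
  set e : ℤ → ℝ := fun n => logEnergy (len a n) (hL.points a n) with he
  have he0 : ∀ n, 0 ≤ e n := fun n => logEnergy_nonneg hL.abs_sub_le_len
  set B : ℤ → Finset ℤ := fun m => Finset.Ico (k m) (k (m + 1)) with hB
  set E : ℤ → ℝ := fun m => ∑ n ∈ B m, e n with hEdef
  have hE0 : ∀ m, 0 ≤ E m := fun m => Finset.sum_nonneg fun n _ => he0 n
  have hEs : Summable fun m => E m / weight (a ∘ k) m := by
    refine Summable.of_norm_bounded_eventually ((summable_block
      (fun n => div_nonneg (he0 n) (weight_pos a n).le)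
      (hE.summable_logEnergy hL ha) hk).mul_left 4) ?_
    rw [Int.cofinite_eq]
    filter_upwards [eventually_weight_le ha hb] with m hm
    have hw := weight_pos (a ∘ k) m
    rw [Real.norm_of_nonneg (div_nonneg (hE0 m) hw.le), hEdef, Finset.sum_div, Finset.mul_sum]
    refine Finset.sum_le_sum fun n hn => ?_
    have hw' := weight_pos a n
    rw [← mul_div_assoc, div_le_div_iff₀ hw hw']
    nlinarith [hm n hn, he0 n]
  -- With R the block length, `T` is large enough that E ≤ R T, so few points are deleted, and small
  -- enough that R T is O(R² + E) when R ≥ 1, which bounds the cost of the scales.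
  set T : ℤ → ℝ := fun m => 1 + E m / len (a ∘ k) m + len (a ∘ k) m with hT
  have hT0 : ∀ m, 0 < T m := fun m => by
    have := hE0 m
    have := hblp m
    positivity
  -- A layer on one side of each endpoint suffices: in a cross pair, the right-hand point lies
  -- beyond the layer of its own cell.
  set D : Set ℝ := {x | x ∈ L ∧ ∃ m, ∃ n ∈ B m, x ∈ interval a n ∧ x ≤ a n + Real.exp (-T m)}
    with hD
  have hDL : D ⊆ L := fun x hx => hx.1
  have hDd : IsDiscreteSeq D := hL.mono hDL
  refine ⟨D, hDL, ?_, fun F hF => ?_⟩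
  · have hDc : ∀ μ > 0, ∀ m, (∀ n ∈ B m, 1 ≤ len a n) → ∀ n ∈ B m,
        (count D a n : ℝ) ≤ 1 + μ + e n / (T m * μ) := by
      intro μ hμ m hm n hn
      have hsub : hDd.points a n ⊆ hL.points a n := fun x hx => by
        rw [IsDiscreteSeq.mem_points] at hx ⊢
        exact ⟨hDL hx.1, hx.2⟩
      rw [← hDd.card_points]
      refine (card_le_of_logEnergy (R := len a n) (hT0 m) hμ fun x hx y hy hxy => ?_).trans ?_
      · have key : ∀ z ∈ hDd.points a n, a n < z ∧ z ≤ a n + Real.exp (-T m) := by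
          intro z hz
          obtain ⟨⟨-, m', n', hn', hz1, hz2⟩, hz3⟩ := (hDd.mem_points).mp hz
          have e1 : n' = n := by
            rw [← (index_eq_iff ha.strictMono hπ).mpr hz1]
            exact (index_eq_iff ha.strictMono hπ).mpr hz3
          rw [e1] at hn' hz2
          rw [block_unique hk hn hn']
          exact ⟨hz3.1, hz2⟩
        have h0 : 0 < |x - y| := abs_pos.mpr (sub_ne_zero.mpr hxy)
        have h1 : |x - y| ≤ Real.exp (-T m) := by
          rw [abs_le]
          constructor <;> linarith [(key x hx).1, (key x hx).2, (key y hy).1, (key y hy).2]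
        rw [Real.le_log_iff_exp_le (div_pos (hlp n) h0), le_div_iff₀ h0]
        calc Real.exp (T m) * |x - y| ≤ Real.exp (T m) * Real.exp (-T m) := by gcongr
          _ = 1 := by rw [← Real.exp_add, add_neg_cancel, Real.exp_zero]
          _ ≤ len a n := hm n hn
      · have := logEnergy_mono hsub hL.abs_sub_le_len
        have := hT0 m
        gcongr
    rw [DensityCondition, isLittleO_iff]
    intro ε hε
    -- With this μ, E ≤ R T makes the energy term at most ε/2 · R. The `1 + μ` points allowed per
    -- cell are absorbed because the old lengths tend to infinity.
    set μ : ℝ := 2 / ε with hμ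
    have hμ0 : 0 < μ := by positivity
    have hA : 0 < 2 * (1 + μ) / ε := by positivity
    filter_upwards [eventually_forall_block (ha.tendsto_len.eventually_ge_atTop 1) hk,
      eventually_forall_block (ha.tendsto_len.eventually_ge_atTop (2 * (1 + μ) / ε)) hk]
      with m hm1 hm2
    rw [zero_mul, sub_zero, Real.norm_of_nonneg (Nat.cast_nonneg _),
      Real.norm_of_nonneg (hblp m).le, count_comp_eq_sum ha.strictMono.monotone hk hDd,
      Nat.cast_sum]
    have h1 : ∑ n ∈ B m, (1 + μ) ≤ ε / 2 * len (a ∘ k) m := by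
      rw [len_comp_eq_sum a hk, Finset.mul_sum]
      refine Finset.sum_le_sum fun n hn => ?_
      have := hm2 n hn
      rw [div_le_iff₀ hε] at this
      linarith
    have h2 : E m / (T m * μ) ≤ ε / 2 * len (a ∘ k) m := by
      have h3 : E m ≤ len (a ∘ k) m * T m := by
        have : len (a ∘ k) m * T m = len (a ∘ k) m + E m + len (a ∘ k) m ^ 2 := by
          simp only [hT]
          have := (hblp m).ne'
          field_simp
        nlinarith [hblp m]
      rw [div_le_iff₀ (mul_pos (hT0 m) hμ0)]
      have : ε / 2 * len (a ∘ k) m * (T m * μ) = len (a ∘ k) m * T m := by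
        rw [hμ]
        field_simp
      rw [this]
      exact h3
    calc ∑ n ∈ B m, (count D a n : ℝ) ≤ ∑ n ∈ B m, ((1 + μ) + e n / (T m * μ)) :=
          Finset.sum_le_sum fun n hn => hDc μ hμ0 m hm1 n hn
      _ = ∑ n ∈ B m, (1 + μ) + E m / (T m * μ) := by
          rw [Finset.sum_add_distrib, ← Finset.sum_div]
      _ ≤ ε * len (a ∘ k) m := by linarith
  · have hFd : IsDiscreteSeq F := hL.mono (hF.trans sdiff_subset)
    rw [energyCondition_iff hFd hb.strictMono]
    set C : ℝ := |d| + 1 with hC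
    have hC0 : 0 ≤ C := by positivity
    have hCn : ∀ᶠ n in atBot ⊔ atTop, (count L a n : ℝ) ≤ C * len a n := by
      filter_upwards [(isLittleO_iff.mp hd) one_pos] with n hn
      rw [Real.norm_eq_abs, Real.norm_of_nonneg (hlp n).le] at hn
      have h1 := (abs_le.mp hn).2
      have h2 := mul_le_mul_of_nonneg_right (le_abs_self d) (hlp n).le
      rw [hC]
      linarith
    -- From `logEnergy_le` come 17 E and 57 C² R²; its `J` term gives 8(7 C R² + 2 C E), and count
    -- times log R at most C R².
    refine Summable.of_norm_bounded_eventually ((hEs.mul_left (17 + 16 * C)).add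
      (hb.short.mul_left (57 * C ^ 2 + 57 * C))) ?_
    rw [Int.cofinite_eq]
    filter_upwards [eventually_forall_block hCn hk, hb.tendsto_len.eventually_ge_atTop 1]
      with m hm hR1
    set R := len (a ∘ k) m with hR
    set S := hFd.points (a ∘ k) m with hS
    have hR0 : 0 < R := by linarith
    have hSd : ∀ x ∈ S, ∀ y ∈ S, |x - y| ≤ R := hFd.abs_sub_le_len
    have hblock : ∀ x ∈ S, π x ∈ B m := by
      intro x hx
      rw [hS, IsDiscreteSeq.mem_points] at hx
      have h1 := ha.strictMono.lt_iff_lt.mp (hx.2.1.trans_le (hπ x).2)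
      have h2 := ha.strictMono.lt_iff_lt.mp ((hπ x).1.trans_le hx.2.2)
      rw [Finset.mem_Ico]
      omega
    have hSn : ∀ n, (S.filter fun x => π x = n) ⊆ hL.points a n := by
      intro n x hx
      rw [Finset.mem_filter, hS, IsDiscreteSeq.mem_points] at hx
      rw [IsDiscreteSeq.mem_points]
      exact ⟨(hF hx.1.1).1, (index_eq_iff ha.strictMono hπ).mp hx.2⟩
    have hSC : ∀ n, ((S.filter fun x => π x = n).card : ℝ) ≤ C * len a n := by
      intro n
      by_cases hn : n ∈ B m
      · refine le_trans ?_ (hm n hn)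
        rw [← hL.card_points]
        exact_mod_cast Finset.card_le_card (hSn n)
      · rw [Finset.filter_false_of_mem fun x hx (hxn : π x = n) => hn (hxn ▸ hblock x hx)]
        have := hlp n
        simp only [Finset.card_empty, Nat.cast_zero]
        positivity
    have hSR : (S.card : ℝ) ≤ C * R := by
      have h1 : S.card = ∑ n ∈ B m, (S.filter fun x => π x = n).card :=
        Finset.card_eq_sum_card_fiberwise fun x hx => hblock x hx
      rw [h1, Nat.cast_sum, hR, len_comp_eq_sum a hk, Finset.mul_sum]
      exact Finset.sum_le_sum fun n _ => hSC n
    have hlenR : ∀ x ∈ S, len a (π x) ≤ R := by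
      intro x hx
      rw [hR, len_comp_eq_sum a hk]
      exact Finset.single_le_sum (f := len a) (fun n _ => (hlp n).le) (hblock x hx)
    have hsep : ∀ x ∈ S, ∀ y ∈ S, π x < π y → Real.exp (-T m) ≤ |x - y| := by
      intro x _ y hy hxy
      have hyF := ((hFd.mem_points).mp hy).1
      have h1 : a (π y) + Real.exp (-T m) < y := by
        by_contra! hc
        exact (hF hyF).2 ⟨(hF hyF).1, m, π y, hblock y hy, hπ y, hc⟩
      have h2 : x ≤ a (π y) := (hπ x).2.trans (ha.strictMono.monotone (by omega))
      rw [abs_sub_comm]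
      exact le_trans (by linarith) (le_abs_self _)
    -- The factor 2 makes `2 ^ J` reach exp(R + T), since log 2 > 1/2.
    set J : ℕ := ⌈2 * (R + T m)⌉₊ with hJdef
    have hJ : ∀ x ∈ S, ∀ y ∈ S, π x ≠ π y → R / |x - y| ≤ 2 ^ J := by
      intro x hx y hy hxy
      have h1 : Real.exp (-T m) ≤ |x - y| := by
        rcases lt_or_gt_of_ne hxy with h | h
        · exact hsep x hx y hy h
        · rw [abs_sub_comm]
          exact hsep y hy x hx h
      have h2 : R ≤ Real.exp R := by linarith [Real.add_one_le_exp R]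
      have h3 : Real.exp (R + T m) ≤ 2 ^ J := by
        rw [← Real.le_log_iff_exp_le (by positivity), Real.log_pow]
        have h4 : 2 * (R + T m) ≤ J := Nat.le_ceil _
        nlinarith [Real.log_two_gt_d9, hT0 m]
      calc R / |x - y| ≤ Real.exp R / Real.exp (-T m) := by gcongr
        _ = Real.exp (R + T m) := by rw [← Real.exp_sub, sub_neg_eq_add]
        _ ≤ 2 ^ J := h3
    have hJle : (J : ℝ) ≤ 7 * R + 2 * (E m / R) := by
      have h1 := (Nat.ceil_lt_add_one (show 0 ≤ 2 * (R + T m) by have := hT0 m; positivity)).le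
      rw [← hJdef] at h1
      simp only [hT] at h1
      rw [← hR] at h1
      linarith
    have hlog := logEnergy_le ha.strictMono.monotone hπ hC0 hSC hR0 hlenR hSd hJ
    have hsum : ∑ n ∈ S.image π, logEnergy (len a n) (S.filter fun x => π x = n) ≤ E m := by
      refine (Finset.sum_le_sum fun n _ => logEnergy_mono (hSn n) hL.abs_sub_le_len).trans ?_
      exact Finset.sum_le_sum_of_subset_of_nonneg (Finset.image_subset_iff.mpr hblock)
        fun n _ _ => he0 n
    have hJS : (J : ℝ) * S.card ≤ 7 * C * R ^ 2 + 2 * C * E m := by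
      calc (J : ℝ) * S.card ≤ (7 * R + 2 * (E m / R)) * (C * R) := by
            have := div_nonneg (hE0 m) hR0.le
            gcongr
        _ = _ := by field_simp
    have hRS : C * R * S.card ≤ C ^ 2 * R ^ 2 := by
      calc C * R * S.card ≤ C * R * (C * R) := by gcongr
        _ = _ := by ring
    have hlogR : Real.log R ≤ R := Real.log_le_self hR0.le
    have hlogR0 : 0 ≤ Real.log R := Real.log_nonneg hR1
    have hcl : (S.card : ℝ) * Real.log R ≤ C * R ^ 2 := by
      calc (S.card : ℝ) * Real.log R ≤ C * R * R := by gcongr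
        _ = _ := by ring
    have hw := weight_pos (a ∘ k) m
    have hnn : 0 ≤ logEnergy R S := logEnergy_nonneg hSd
    rw [← hFd.card_points]
    change ‖(logEnergy R S + S.card * Real.log R) / weight (a ∘ k) m‖ ≤ _
    rw [Real.norm_of_nonneg (by positivity), ← mul_div_assoc, ← mul_div_assoc, ← add_div]
    refine div_le_div_of_nonneg_right ?_ hw.le
    nlinarith

/-! ### Arithmetic of densities and the two conclusions -/

theorem count_diff_add {L G : Set ℝ} (hL : IsDiscreteSeq L) (hG : G ⊆ L) (a : ℤ → ℝ) (n : ℤ) :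
    count (L \ G) a n + count G a n = count L a n := by
  have h : (L ∩ interval a n) \ (G ∩ interval a n) = (L \ G) ∩ interval a n := by
    ext x
    simp only [Set.mem_sdiff, mem_inter_iff]
    tauto
  unfold count
  rw [← h]
  exact ncard_sdiff_add_ncard_of_subset (inter_subset_inter_left _ hG) (hL.finite_inter_Ioc _ _)

theorem DensityCondition.diff {L G : Set ℝ} {d c : ℝ} (hLd : IsDiscreteSeq L) (hGL : G ⊆ L)
    (hL : DensityCondition d L a) (hG : DensityCondition c G a) :
    DensityCondition (d - c) (L \ G) a := by
  refine (hL.sub hG).congr_left fun n => ?_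
  rw [← count_diff_add hLd hGL a n]
  push_cast
  ring

theorem DensityCondition.union {G₁ G₂ : Set ℝ} {c₁ c₂ : ℝ} (hd : IsDiscreteSeq (G₁ ∪ G₂))
    (hdis : Disjoint G₁ G₂) (h₁ : DensityCondition c₁ G₁ a) (h₂ : DensityCondition c₂ G₂ a) :
    DensityCondition (c₁ + c₂) (G₁ ∪ G₂) a := by
  refine (h₁.add h₂).congr_left fun n => ?_
  have h := count_diff_add hd (subset_union_right (s := G₁)) a n
  rw [union_sdiff_right, hdis.sdiff_eq_left] at h
  rw [← h]
  push_cast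
  ring

theorem DensityCondition.zero_of_subset {D X : Set ℝ} (hDd : IsDiscreteSeq D) (hX : X ⊆ D)
    (hD : DensityCondition 0 D a) : DensityCondition 0 X a := by
  refine IsBigO.trans_isLittleO (IsBigO.of_norm_le fun n => ?_) hD
  simp only [zero_mul, sub_zero, Real.norm_natCast, Nat.cast_le]
  exact ncard_le_ncard (inter_subset_inter_left _ hX) (hDd.finite_inter_Ioc _ _)

theorem DensityCondition.diff_zero {L D : Set ℝ} {d : ℝ} (hLd : IsDiscreteSeq L)
    (hDd : IsDiscreteSeq D) (hL : DensityCondition d L a) (hD : DensityCondition 0 D a) :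
    DensityCondition d (L \ D) a := by
  have := hL.diff hLd inter_subset_left (hD.zero_of_subset hDd (inter_subset_right (s := L)))
  rwa [sub_zero, sdiff_self_inter] at this

theorem DensityCondition.nonneg {L : Set ℝ} {d : ℝ} (ha : StrictMono a)
    (h : DensityCondition d L a) : 0 ≤ d := by
  by_contra! hd
  have : NeBot (atBot ⊔ atTop : Filter ℤ) := atTop_neBot.mono le_sup_right
  obtain ⟨n, hn⟩ := ((isLittleO_iff.mp h) (show 0 < -d / 2 by linarith)).exists
  have hl := len_pos ha n
  rw [Real.norm_eq_abs, Real.norm_of_nonneg hl.le] at hn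
  have h1 := (abs_le.mp hn).2
  have h2 : (0 : ℝ) ≤ count L a n := Nat.cast_nonneg _
  nlinarith

/-- The complement of a `c`-uniform subsequence of a `d`-uniform sequence contains a
`(d - c)`-uniform subsequence, unless `c = d`. -/
theorem IsUniform.exists_subset_diff {c d : ℝ} {L G : Set ℝ} (hL : IsUniform d L) (hGL : G ⊆ L)
    (hG : IsUniform c G) (hcd : c ≠ d) : ∃ F ⊆ L \ G, IsUniform (d - c) F := by
  obtain ⟨-, hLd, a, ha, hLa, hLE⟩ := hL
  obtain ⟨-, hGd, a', ha', hGa', -⟩ := hG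
  obtain ⟨k, hk, hb, hdens⟩ := exists_coarsening ha ha'
  obtain ⟨D, hDL, hD0, hDE⟩ := exists_negligible_energyCondition hLd ha hLa hLE hk hb
  have hdiff : DensityCondition (d - c) (L \ G) (a ∘ k) :=
    (hLa.coarsen hLd ha.strictMono hk).diff hLd hGL (hdens c G hGd hGa')
  -- Counts are nonnegative, so d - c ≥ 0; the assumption c ≠ d makes it strict.
  have hpos : 0 < d - c := lt_of_le_of_ne (hdiff.nonneg hb.strictMono)
    (sub_ne_zero.mpr hcd.symm).symm
  have hLGd : IsDiscreteSeq (L \ G) := hLd.mono Set.sdiff_subset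
  refine ⟨(L \ G) \ D, Set.sdiff_subset, hpos, hLGd.mono Set.sdiff_subset, a ∘ k, hb,
    hdiff.diff_zero hLGd (hLd.mono hDL) hD0, hDE _ (Set.sdiff_subset_sdiff_left Set.sdiff_subset)⟩

/-- The union of two disjoint uniform subsequences of a uniform sequence contains a uniform
subsequence of density the sum of their densities. -/
theorem IsUniform.exists_subset_union {c₁ c₂ d : ℝ} {L G₁ G₂ : Set ℝ} (hL : IsUniform d L)
    (hG₁L : G₁ ⊆ L) (hG₂L : G₂ ⊆ L) (hG₁ : IsUniform c₁ G₁) (hG₂ : IsUniform c₂ G₂)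
    (hdis : Disjoint G₁ G₂) : ∃ F ⊆ G₁ ∪ G₂, IsUniform (c₁ + c₂) F := by
  obtain ⟨-, hLd, a, ha, hLa, hLE⟩ := hL
  obtain ⟨hc₁, hG₁d, a₁, ha₁, hGa₁, -⟩ := hG₁
  obtain ⟨hc₂, hG₂d, a₂, ha₂, hGa₂, -⟩ := hG₂
  obtain ⟨k, hk, hb, hdens₁⟩ := exists_coarsening ha ha₁
  -- The second coarsening starts from the first, since a density already secured survives further
  -- merging.
  obtain ⟨k', hk', hb', hdens₂⟩ := exists_coarsening hb ha₂
  obtain ⟨D, hDL, hD0, hDE⟩ :=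
    exists_negligible_energyCondition hLd ha hLa hLE (hk.comp hk') hb'
  have hUL : G₁ ∪ G₂ ⊆ L := Set.union_subset hG₁L hG₂L
  have hUd : IsDiscreteSeq (G₁ ∪ G₂) := hLd.mono hUL
  have hU : DensityCondition (c₁ + c₂) (G₁ ∪ G₂) ((a ∘ k) ∘ k') :=
    ((hdens₁ c₁ G₁ hG₁d hGa₁).coarsen hG₁d hb.strictMono hk').union hUd hdis
      (hdens₂ c₂ G₂ hG₂d hGa₂)
  exact ⟨(G₁ ∪ G₂) \ D, Set.sdiff_subset, add_pos hc₁ hc₂, hUd.mono Set.sdiff_subset,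
    (a ∘ k) ∘ k', hb', hU.diff_zero hUd (hLd.mono hDL) hD0,
    hDE _ (Set.sdiff_subset_sdiff_left hUL)⟩

end UniformSeq

end

theorem lemma9p2 (d : ℝ) (L : Set ℝ) (hL : UniformSeq.IsUniform d L) :
    (∀ (c : ℝ) (G : Set ℝ), G ⊆ L → UniformSeq.IsUniform c G → c ≠ d →
      ∃ F : Set ℝ, F ⊆ L \ G ∧ UniformSeq.IsUniform (d - c) F) ∧
    (∀ (c₁ c₂ : ℝ) (G₁ G₂ : Set ℝ), G₁ ⊆ L → G₂ ⊆ L →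
      UniformSeq.IsUniform c₁ G₁ → UniformSeq.IsUniform c₂ G₂ → Disjoint G₁ G₂ →
      ∃ F : Set ℝ, F ⊆ G₁ ∪ G₂ ∧ UniformSeq.IsUniform (c₁ + c₂) F) :=
  ⟨fun _ _ hGL hG hcd => hL.exists_subset_diff hGL hG hcd,
    fun _ _ _ _ h₁ h₂ hG₁ hG₂ hdis => hL.exists_subset_union h₁ h₂ hG₁ hG₂ hdis⟩
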